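/- An existential first-order sentence over posets is a sentence $\varphi=\exists x_1\cdots\exists x_q\,\psi(x_1,\dots,x_q)$ where $\psi$ is built with $\wedge$ and $\vee$ from atoms $x_i=x_j$, $x_i\le x_j$ and negated atoms; $|\varphi|$ is its number of symbols. The width of a finite poset is the maximum cardinality of an antichain. **Theorem.** The problem of deciding, for a given existential first-order sentence $\varphi$ and a given finite poset $\mathcal P=(P,\le^P)$, whether $\mathcal P\models\varphi$, is fixed-parameter tractable with respect to $|\varphi|$ and the width of $\mathcal P$. Precisely, there are a single algorithm, a computable function $h:\mathbb N\times\mathbb N\to\mathbb N$ and a constant $C$ such that for every existential first-order sentence $\varphi$ and every finite poset $\mathcal P$ with $n$ elements and width $w$, the algorithm, given $\varphi$ and the $n\times n$ table of $\le^P$, decides correctly whether $\mathcal P\models\varphi$ in at most $h(|\varphi|,w)\cdot C\cdot\max(n,1)^2$ steps. Here an algorithm is a program of a random access machine with addition, truncated subtraction, halving and indirect addressing, under the uniform cost measure. -/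

import Mathlib

/-! ## Existential first-order sentences over the vocabulary `{≤}` -/

/-- Quantifier-free formulas in the variables `x_0, …, x_{q-1}`, with negations only in front of
atoms; the atoms are `x_i = x_j` and `x_i ≤ x_j`. -/
inductive QFFormula (q : ℕ) : Type
  | eq (i j : Fin q) : QFFormula q
  | le (i j : Fin q) : QFFormula q
  | ne (i j : Fin q) : QFFormula q
  | nle (i j : Fin q) : QFFormula q
  | and (ψ₁ ψ₂ : QFFormula q) : QFFormula q
  | or (ψ₁ ψ₂ : QFFormula q) : QFFormula q

namespace QFFormula

/-- Number of symbols of a quantifier-free formula. -/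
def size {q : ℕ} : QFFormula q → ℕ
  | eq _ _ => 3
  | le _ _ => 3
  | ne _ _ => 4
  | nle _ _ => 4
  | and ψ₁ ψ₂ => ψ₁.size + ψ₂.size + 1
  | or ψ₁ ψ₂ => ψ₁.size + ψ₂.size + 1

/-- Reverse Polish notation, as a list of numbers. -/
def encode {q : ℕ} : QFFormula q → List ℕ
  | eq i j => [0, (i : ℕ), (j : ℕ)]
  | le i j => [1, (i : ℕ), (j : ℕ)]
  | ne i j => [2, (i : ℕ), (j : ℕ)]
  | nle i j => [3, (i : ℕ), (j : ℕ)]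
  | and ψ₁ ψ₂ => ψ₁.encode ++ ψ₂.encode ++ [4]
  | or ψ₁ ψ₂ => ψ₁.encode ++ ψ₂.encode ++ [5]

/-- The formula as a first-order formula of Mathlib, in the language of orders. -/
def toFormula {q : ℕ} : QFFormula q → FirstOrder.Language.order.BoundedFormula Empty q
  | eq i j => FirstOrder.Language.Term.bdEqual
      (FirstOrder.Language.Term.var (Sum.inr i)) (FirstOrder.Language.Term.var (Sum.inr j))
  | le i j => FirstOrder.Language.Term.le
      (FirstOrder.Language.Term.var (Sum.inr i)) (FirstOrder.Language.Term.var (Sum.inr j))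
  | ne i j => (FirstOrder.Language.Term.bdEqual
      (FirstOrder.Language.Term.var (Sum.inr i)) (FirstOrder.Language.Term.var (Sum.inr j))).not
  | nle i j => (FirstOrder.Language.Term.le
      (FirstOrder.Language.Term.var (Sum.inr i)) (FirstOrder.Language.Term.var (Sum.inr j))).not
  | and ψ₁ ψ₂ => ψ₁.toFormula ⊓ ψ₂.toFormula
  | or ψ₁ ψ₂ => ψ₁.toFormula ⊔ ψ₂.toFormula

end QFFormula

/-- Existential first-order sentences `∃ x_0 … ∃ x_{q-1}. ψ` in prefix normal form. -/
structure ExSentence : Type where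
  /-- the number of quantifiers -/
  q : ℕ
  /-- the quantifier-free part -/
  body : QFFormula q

namespace ExSentence

/-- `|φ|`: the number of symbols of the sentence. -/
def size (φ : ExSentence) : ℕ := 2 * φ.q + φ.body.size

/-- The sentence as a first-order sentence of Mathlib, in the language of orders. -/
def toSentence (φ : ExSentence) : FirstOrder.Language.order.Sentence := φ.body.toFormula.exs

/-- `P ⊨ φ`, where the relation symbol is interpreted by the order of `P`. -/
def Models (P : Type*) [PartialOrder P] (φ : ExSentence) : Prop :=
  @FirstOrder.Language.Sentence.Realize FirstOrder.Language.order P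
    (FirstOrder.Language.orderStructure P) φ.toSentence

end ExSentence

/-! ## Width -/

/-- The width of a finite poset: the maximum cardinality of an antichain. -/
noncomputable def posetWidth (P : Type*) [PartialOrder P] : ℕ :=
  sSup {k : ℕ | ∃ A : Finset P, IsAntichain (· ≤ ·) (A : Set P) ∧ A.card = k}

/-! ## Random access machines with uniform cost -/

/-- Instructions of a random access machine. Registers and memory cells hold natural numbers;
the only arithmetic operations are addition, truncated subtraction and halving. -/
inductive RamInstr : Type
  /-- `R_d := c` -/
  | const (d c : ℕ) : RamInstr
  /-- `R_d := R_a` -/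
  | move (d a : ℕ) : RamInstr
  /-- `R_d := R_a + R_b` -/
  | add (d a b : ℕ) : RamInstr
  /-- `R_d := max (R_a - R_b) 0` -/
  | sub (d a b : ℕ) : RamInstr
  /-- `R_d := ⌊R_a / 2⌋` -/
  | half (d a : ℕ) : RamInstr
  /-- `R_d := M[R_a]` -/
  | load (d a : ℕ) : RamInstr
  /-- `M[R_a] := R_b` -/
  | store (a b : ℕ) : RamInstr
  /-- continue with instruction number `l` -/
  | jump (l : ℕ) : RamInstr
  /-- continue with instruction number `l` if `R_a = 0`, otherwise with the next instruction -/
  | jzero (a l : ℕ) : RamInstr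

/-- A program is a finite list of instructions, numbered from `0`. In particular it uses only
finitely many registers, whatever the input is. -/
abbrev RamProg : Type := List RamInstr

/-- A configuration: program counter, registers, memory. -/
structure RamConfig : Type where
  pc : ℕ
  reg : ℕ → ℕ
  mem : ℕ → ℕ

namespace RamInstr

/-- The effect of one instruction. -/
def exec (c : RamConfig) : RamInstr → RamConfig
  | const d k => ⟨c.pc + 1, Function.update c.reg d k, c.mem⟩
  | move d a => ⟨c.pc + 1, Function.update c.reg d (c.reg a), c.mem⟩
  | add d a b => ⟨c.pc + 1, Function.update c.reg d (c.reg a + c.reg b), c.mem⟩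
  | sub d a b => ⟨c.pc + 1, Function.update c.reg d (c.reg a - c.reg b), c.mem⟩
  | half d a => ⟨c.pc + 1, Function.update c.reg d (c.reg a / 2), c.mem⟩
  | load d a => ⟨c.pc + 1, Function.update c.reg d (c.mem (c.reg a)), c.mem⟩
  | store a b => ⟨c.pc + 1, c.reg, Function.update c.mem (c.reg a) (c.reg b)⟩
  | jump l => ⟨l, c.reg, c.mem⟩
  | jzero a l => ⟨if c.reg a = 0 then l else c.pc + 1, c.reg, c.mem⟩

end RamInstr

namespace RamProg

/-- The machine halts when the program counter points to no instruction. -/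
def Halted (p : RamProg) (c : RamConfig) : Prop := p.length ≤ c.pc

/-- One step of the machine; a halted machine does not move. -/
def step (p : RamProg) (c : RamConfig) : RamConfig :=
  match p[c.pc]? with
  | some i => i.exec c
  | none => c

/-- The initial configuration: the input is written in the memory cells `0, 1, 2, …`, everything
else is `0`. -/
def init (x : List ℕ) : RamConfig := ⟨0, fun _ => 0, fun a => x.getD a 0⟩

/-- On input `x` the program halts after at most `T` steps with the number `y` in register `0`. -/
def OutputsWithin (p : RamProg) (x : List ℕ) (y T : ℕ) : Prop :=
  ∃ t ≤ T, p.Halted (p.step^[t] (init x)) ∧ (p.step^[t] (init x)).reg 0 = y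

end RamProg

/-! ## Instances of the model checking problem -/

open Classical in
/-- The 0/1-matrix of the order of an `n`-element poset, row by row, where `e` lists the
elements. -/
noncomputable def orderTable {P : Type*} [PartialOrder P] {n : ℕ} (e : Fin n ≃ P) : List ℕ :=
  (List.finRange n).flatMap fun i => (List.finRange n).map fun j => if e i ≤ e j then 1 else 0

/-- The input for a sentence `φ` and a poset with `n` elements listed by `e`: the number `n`, the
number of quantifiers, the length of the code of the quantifier-free part, the order table, and
the code of the quantifier-free part. -/
noncomputable def encodeInstance (φ : ExSentence) {P : Type*} [PartialOrder P] {n : ℕ}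
    (e : Fin n ≃ P) : List ℕ :=
  n :: φ.q :: φ.body.encode.length :: (orderTable e ++ φ.body.encode)

/-!
A poset of width `w` is a union of `w` chains (Dilworth). Suppose that for each of the `q` variables
of the sentence we know the chain that contains its value, and for each pair of variables whether
`x_i ≤ x_j`. Among all assignments with this pattern there is a least one, and it is found greedily:
every variable starts at the least element of its chain, and as long as some prescribed relation
`x_i ≤ x_j` or `¬ x_i ≤ x_j` fails, one of the two variables, which the failing relation determines,
must move up in its chain. There are `2 ^ (q * q + q * w)` patterns to try, coded by binary digits.

The chains are found in quadratic time by adding the elements one at a time. The same greedy search,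
which now asks for an antichain with one element on each of the current chains, either finds such an
antichain, so that the number of chains is at most `w`, or runs off the end of a chain, and then the
moves of the pointers form an augmenting path along which the number of chains is reduced by one.

The algorithm is written in a small imperative language, in which its correctness and its cost are
proved, and the language is compiled to random access machines.
-/

/-! ## Chain covers of order tables -/

/-- `tab` is the 0/1-table of a partial order on `{0, …, n - 1}`. -/
structure IsOrderTable (tab : ℕ → ℕ → ℕ) (n : ℕ) : Prop where
  le_one : ∀ a < n, ∀ b < n, tab a b ≤ 1
  refl : ∀ a < n, tab a a = 1
  trans : ∀ a < n, ∀ b < n, ∀ c < n, tab a b = 1 → tab b c = 1 → tab a c = 1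
  antisymm : ∀ a < n, ∀ b < n, tab a b = 1 → tab b a = 1 → a = b

/-- The width of the poset with order table `tab` on `{0, …, n - 1}` is at most `w`. -/
def WidthLE (tab : ℕ → ℕ → ℕ) (n w : ℕ) : Prop :=
  ∀ (m : ℕ) (f : ℕ → ℕ), (∀ i < m, f i < n) →
    (∀ i < m, ∀ j < m, i ≠ j → tab (f i) (f j) ≠ 1) → m ≤ w

/-- The number of elements strictly below `x`. -/
def height (tab : ℕ → ℕ → ℕ) (n x : ℕ) : ℕ :=
  ((Finset.range n).filter fun y => tab y x = 1 ∧ y ≠ x).card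

/-- `prv` codes a matching of the comparability graph on `{0, …, v - 1}`, that is, a partition into
chains: `prv y = x + 1` says that `x` precedes `y` in its chain, and `prv y = 0` that `y` is the
least element of its chain. -/
structure IsMatching (tab : ℕ → ℕ → ℕ) (prv : ℕ → ℕ) (v : ℕ) : Prop where
  edge : ∀ y < v, ∀ x, prv y = x + 1 → x < v ∧ tab x y = 1 ∧ x ≠ y
  inj : ∀ y < v, ∀ z < v, ∀ x, prv y = x + 1 → prv z = x + 1 → y = z

/-- The number of chains. -/
def chainCount (prv : ℕ → ℕ) (v : ℕ) : ℕ := ((Finset.range v).filter fun x => prv x = 0).card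

/-- The successor map `nxt`, coded like `prv`, and the list `head 0, …, head (m - 1)` of least
elements belong to the partition into chains that is given by `prv`. -/
structure IsChainData (prv nxt head : ℕ → ℕ) (v m : ℕ) : Prop where
  prv_of_nxt : ∀ x < v, ∀ y, nxt x = y + 1 → y < v ∧ prv y = x + 1
  nxt_of_prv : ∀ y < v, ∀ x, prv y = x + 1 → nxt x = y + 1
  bijOn_head : Set.BijOn head (Set.Iio m) {y | y < v ∧ prv y = 0}

/-- The partial map `nxt`, coded like `prv`, leads to strictly greater elements. -/
def Ascends (tab : ℕ → ℕ → ℕ) (nxt : ℕ → ℕ) (n : ℕ) : Prop :=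
  ∀ x < n, ∀ y, nxt x = y + 1 → y < n ∧ tab x y = 1 ∧ x ≠ y

/-- `y` is reached from `x` in a number of steps of the partial map `nxt`. -/
def ChainReach (nxt : ℕ → ℕ) : ℕ → ℕ → Prop := Relation.ReflTransGen fun x y => nxt x = y + 1

section ChainCover

variable {tab : ℕ → ℕ → ℕ} {prv nxt head : ℕ → ℕ} {n m v w x y : ℕ}

theorem IsOrderTable.mono (h : IsOrderTable tab n) (hv : v ≤ n) : IsOrderTable tab v where
  le_one a ha b hb := h.le_one a (by omega) b (by omega)
  refl a ha := h.refl a (by omega)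
  trans a ha b hb c hc := h.trans a (by omega) b (by omega) c (by omega)
  antisymm a ha b hb := h.antisymm a (by omega) b (by omega)

theorem WidthLE.mono (h : WidthLE tab n w) (hv : v ≤ n) : WidthLE tab v w :=
  fun m f hf => h m f fun i hi => (hf i hi).trans_le hv

theorem height_lt (hx : x < n) : height tab n x < n := by
  have hss : (Finset.range n).filter (fun y => tab y x = 1 ∧ y ≠ x) ⊂ Finset.range n :=
    Finset.filter_ssubset.2 ⟨x, Finset.mem_range.2 hx, by simp⟩
  exact (Finset.card_lt_card hss).trans_eq (Finset.card_range n)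

theorem IsOrderTable.height_lt_height (h : IsOrderTable tab n) (hx : x < n) (hy : y < n)
    (hxy : tab x y = 1) (hne : x ≠ y) : height tab n x < height tab n y := by
  refine Finset.card_lt_card (Finset.ssubset_iff_of_subset ?_ |>.2 ⟨x, ?_, ?_⟩)
  · intro z hz
    simp only [Finset.mem_filter, Finset.mem_range] at hz ⊢
    refine ⟨hz.1, h.trans z hz.1 x hx y hy hz.2.1 hxy, ?_⟩
    rintro rfl
    exact hne (h.antisymm x hx z hy hxy hz.2.1)
  · simp [hx, hxy, hne]
  · simp

theorem isMatching_zero (tab : ℕ → ℕ → ℕ) (prv : ℕ → ℕ) : IsMatching tab prv 0 :=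
  ⟨fun _ h => absurd h (Nat.not_lt_zero _), fun _ h => absurd h (Nat.not_lt_zero _)⟩

theorem IsMatching.update (h : IsMatching tab prv v) (hx : x < v) (hxy : tab x y = 1) (hne : x ≠ y)
    (hfree : ∀ z < v, prv z ≠ x + 1) : IsMatching tab (Function.update prv y (x + 1)) v where
  edge z hz u hu := by
    rcases eq_or_ne z y with rfl | hzy
    · obtain rfl : x = u := by simpa using hu
      exact ⟨hx, hxy, hne⟩
    · exact h.edge z hz u (by simpa [hzy] using hu)
  inj z₁ hz₁ z₂ hz₂ u h₁ h₂ := by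
    by_cases e₁ : z₁ = y <;> by_cases e₂ : z₂ = y
    · exact e₁.trans e₂.symm
    · simp only [e₁, Function.update_self, Function.update_of_ne e₂] at h₁ h₂
      exact absurd (h₂.trans h₁.symm) (hfree z₂ hz₂)
    · simp only [e₂, Function.update_self, Function.update_of_ne e₁] at h₁ h₂
      exact absurd (h₁.trans h₂.symm) (hfree z₁ hz₁)
    · exact h.inj z₁ hz₁ z₂ hz₂ u (by simpa [e₁] using h₁) (by simpa [e₂] using h₂)

theorem IsMatching.extend (h : IsMatching tab prv v) :
    IsMatching tab (Function.update prv v 0) (v + 1) := by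
  have old {y x : ℕ} (hy : y < v + 1) (hyx : Function.update prv v 0 y = x + 1) :
      y < v ∧ prv y = x + 1 := by
    have hne : y ≠ v := by rintro rfl; simp at hyx
    exact ⟨by omega, by simpa [hne] using hyx⟩
  refine ⟨fun y hy x hyx => ?_, fun y hy z hz x hyx hzx => ?_⟩
  · obtain ⟨hx, hle⟩ := h.edge y (old hy hyx).1 x (old hy hyx).2
    exact ⟨hx.trans (Nat.lt_succ_self v), hle⟩
  · exact h.inj y (old hy hyx).1 z (old hz hzx).1 x (old hy hyx).2 (old hz hzx).2

theorem chainCount_extend (prv : ℕ → ℕ) (v : ℕ) :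
    chainCount (Function.update prv v 0) (v + 1) = chainCount prv v + 1 := by
  have hold : (Finset.range v).filter (fun x => Function.update prv v 0 x = 0) =
      (Finset.range v).filter fun x => prv x = 0 :=
    Finset.filter_congr fun x hx => by rw [Function.update_of_ne (Finset.mem_range.1 hx).ne]
  simp [chainCount, Finset.range_add_one, Finset.filter_insert, hold]

theorem chainCount_update_of_eq_zero (hy : y < v) (h : prv y = 0) :
    chainCount (Function.update prv y (x + 1)) v + 1 = chainCount prv v := by
  have herase : (Finset.range v).filter (fun z => Function.update prv y (x + 1) z = 0) =
      ((Finset.range v).filter fun z => prv z = 0).erase y := by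
    ext z
    by_cases hz : z = y <;> simp [hz]
  rw [chainCount, herase, Finset.card_erase_add_one (by simp [hy, h]), chainCount]

theorem chainCount_update_of_ne_zero (h : prv y ≠ 0) :
    chainCount (Function.update prv y (x + 1)) v = chainCount prv v := by
  refine congrArg Finset.card (Finset.filter_congr fun z _ => ?_)
  by_cases hz : z = y <;> simp [hz, h]

theorem IsChainData.eq_chainCount (h : IsChainData prv nxt head v m) : m = chainCount prv v := by
  have hbij : Set.BijOn head (Finset.range m) ((Finset.range v).filter fun x => prv x = 0) := by
    convert h.bijOn_head using 1 <;> ext <;> simp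
  rw [chainCount, ← Finset.card_nbij head hbij.mapsTo hbij.injOn hbij.surjOn, Finset.card_range]

theorem IsChainData.head_lt (h : IsChainData prv nxt head v m) {i : ℕ} (hi : i < m) : head i < v :=
  (h.bijOn_head.mapsTo hi).1

theorem IsChainData.prv_head (h : IsChainData prv nxt head v m) {i : ℕ} (hi : i < m) :
    prv (head i) = 0 :=
  (h.bijOn_head.mapsTo hi).2

theorem IsChainData.ascends (h : IsChainData prv nxt head v m) (hM : IsMatching tab prv v) :
    Ascends tab nxt v := fun x hx y hxy => by
  obtain ⟨hy, hyx⟩ := h.prv_of_nxt x hx y hxy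
  exact ⟨hy, (hM.edge y hy x hyx).2⟩

theorem ChainReach.lt_and_le (h : ChainReach nxt x y) (hO : IsOrderTable tab n)
    (hN : Ascends tab nxt n) (hx : x < n) : y < n ∧ tab x y = 1 := by
  induction h with
  | refl => exact ⟨hx, hO.refl x hx⟩
  | @tail y z _ hyz ih =>
    obtain ⟨hy, hxy⟩ := ih
    obtain ⟨hz, hyz, -⟩ := hN y hy z hyz
    exact ⟨hz, hO.trans x hx y hy z hz hxy hyz⟩

theorem IsChainData.exists_chainReach (hC : IsChainData prv nxt head n m)
    (hO : IsOrderTable tab n) (hM : IsMatching tab prv n) (hy : y < n) :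
    ∃ j < m, ChainReach nxt (head j) y := by
  induction hh : height tab n y using Nat.strong_induction_on generalizing y with
  | _ h ih =>
    rcases hpy : prv y with _ | x
    · obtain ⟨j, hj, rfl⟩ := hC.bijOn_head.surjOn ⟨hy, hpy⟩
      exact ⟨j, hj, Relation.ReflTransGen.refl⟩
    · obtain ⟨hx, hxy, hne⟩ := hM.edge y hy x hpy
      obtain ⟨j, hj, hr⟩ := ih _ (hh ▸ hO.height_lt_height hx hy hxy hne) hx rfl
      exact ⟨j, hj, hr.tail (hC.nxt_of_prv y hy x hpy)⟩

end ChainCover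

/-! ## Advancing pointers along chains -/

/-- The constraint between the pointers `a` and `b` is violated and requires that `a` advances.
A constraint is coded by `1` if it demands `≤`, by `0` if it demands `≰`, and by another number if
it demands nothing. -/
def Violated (con : ℕ → ℕ) (m : ℕ) (tab : ℕ → ℕ → ℕ) (ptr : ℕ → ℕ) (a b : ℕ) : Prop :=
  (con (a * m + b) = 0 ∧ tab (ptr a) (ptr b) = 1) ∨ (con (b * m + a) = 1 ∧ tab (ptr b) (ptr a) = 0)

/-- All constraints hold; see `Violated` for their codes. -/
def AllHold (con : ℕ → ℕ) (m : ℕ) (tab : ℕ → ℕ → ℕ) (ptr : ℕ → ℕ) : Prop :=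
  ∀ a < m, ∀ b < m, con (a * m + b) + tab (ptr a) (ptr b) ≠ 1

/-- `PointerRun con m tab nxt ptr₀ wit₀ t ptr wit`: starting with `ptr₀` and `wit₀`, the pointers
can stand at `ptr` after `t` advances, each of which was required by a violated constraint. When
pointer `a` leaves an element because of pointer `b`, the position of `b` is recorded in `wit`. -/
inductive PointerRun (con : ℕ → ℕ) (m : ℕ) (tab : ℕ → ℕ → ℕ) (nxt ptr₀ wit₀ : ℕ → ℕ) :
    ℕ → (ℕ → ℕ) → (ℕ → ℕ) → Prop
  | start : PointerRun con m tab nxt ptr₀ wit₀ 0 ptr₀ wit₀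
  | advance {t : ℕ} {ptr wit : ℕ → ℕ} {a b x : ℕ} :
    PointerRun con m tab nxt ptr₀ wit₀ t ptr wit → a < m → b < m → Violated con m tab ptr a b →
    nxt (ptr a) = x + 1 → PointerRun con m tab nxt ptr₀ wit₀ (t + 1) (Function.update ptr a x)
      (Function.update wit (ptr a) (ptr b))

section PointerRun

variable {con : ℕ → ℕ} {m n t a b : ℕ} {tab : ℕ → ℕ → ℕ} {nxt ptr₀ wit₀ ptr wit s : ℕ → ℕ}

theorem PointerRun.chainReach (h : PointerRun con m tab nxt ptr₀ wit₀ t ptr wit) (i : ℕ) :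
    ChainReach nxt (ptr₀ i) (ptr i) := by
  induction h with
  | start => exact .refl
  | @advance _ ptr _ a b x _ _ _ _ hx ih =>
    rcases eq_or_ne i a with rfl | hia
    · rw [Function.update_self]
      exact ih.tail hx
    · rwa [Function.update_of_ne hia]

theorem PointerRun.ptr_lt (h : PointerRun con m tab nxt ptr₀ wit₀ t ptr wit)
    (hO : IsOrderTable tab n) (hN : Ascends tab nxt n) (h₀ : ∀ i < m, ptr₀ i < n) :
    ∀ i < m, ptr i < n :=
  fun i hi => ((h.chainReach i).lt_and_le hO hN (h₀ i hi)).1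

theorem PointerRun.le_sum_height (h : PointerRun con m tab nxt ptr₀ wit₀ t ptr wit)
    (hO : IsOrderTable tab n) (hN : Ascends tab nxt n) (h₀ : ∀ i < m, ptr₀ i < n) :
    t ≤ ∑ i ∈ Finset.range m, height tab n (ptr i) := by
  induction h with
  | start => exact Nat.zero_le _
  | @advance t ptr wit a b x h ha _ _ hx ih =>
    have hpa := h.ptr_lt hO hN h₀ a ha
    obtain ⟨hxn, hle, hne⟩ := hN _ hpa x hx
    refine Nat.succ_le_of_lt (ih.trans_lt (Finset.sum_lt_sum (fun i _ => ?_)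
      ⟨a, Finset.mem_range.2 ha, by simpa using hO.height_lt_height hpa hxn hle hne⟩))
    rcases eq_or_ne i a with rfl | hia
    · simpa using (hO.height_lt_height hpa hxn hle hne).le
    · rw [Function.update_of_ne hia]

theorem PointerRun.length_le (h : PointerRun con m tab nxt ptr₀ wit₀ t ptr wit)
    (hO : IsOrderTable tab n) (hN : Ascends tab nxt n) (h₀ : ∀ i < m, ptr₀ i < n) : t ≤ m * n :=
  calc t ≤ ∑ i ∈ Finset.range m, height tab n (ptr i) := h.le_sum_height hO hN h₀
    _ ≤ ∑ _i ∈ Finset.range m, n :=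
      Finset.sum_le_sum fun i hi => (height_lt (h.ptr_lt hO hN h₀ i (Finset.mem_range.1 hi))).le
    _ = m * n := by simp

/-- Monotonicity in the other pointer: if pointer `a` stood at its goal already, the violated
constraint would be violated by the solution, too. -/
theorem Violated.exists_nxt (h : Violated con m tab ptr a b) (ha : a < m) (hb : b < m)
    (hO : IsOrderTable tab n) (hN : Ascends tab nxt n) (hptr : ∀ i < m, ptr i < n)
    (hs : ∀ i < m, ∀ j < m, con (i * m + j) = tab (s i) (s j))
    (hreach : ∀ i < m, ChainReach nxt (ptr i) (s i)) :
    ∃ x, nxt (ptr a) = x + 1 ∧ ChainReach nxt x (s a) := by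
  obtain ⟨hsb, hle⟩ := (hreach b hb).lt_and_le hO hN (hptr b hb)
  have hpa := hptr a ha
  rcases Relation.ReflTransGen.cases_head (hreach a ha) with heq | hstep
  · rcases h with ⟨hcon, hab⟩ | ⟨hcon, hba⟩
    · have := hO.trans _ hpa _ (hptr b hb) _ hsb hab hle
      rw [hs a ha b hb, ← heq, this] at hcon
      exact absurd hcon one_ne_zero
    · rw [hs b hb a ha, ← heq] at hcon
      have := hO.trans _ (hptr b hb) _ hsb _ hpa hle hcon
      rw [hba] at this
      exact absurd this zero_ne_one
  · exact hstep

theorem PointerRun.chainReach_solution (h : PointerRun con m tab nxt ptr₀ wit₀ t ptr wit)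
    (hO : IsOrderTable tab n) (hN : Ascends tab nxt n) (h₀ : ∀ i < m, ptr₀ i < n)
    (hs : ∀ i < m, ∀ j < m, con (i * m + j) = tab (s i) (s j))
    (hreach : ∀ i < m, ChainReach nxt (ptr₀ i) (s i)) : ∀ i < m, ChainReach nxt (ptr i) (s i) := by
  induction h with
  | start => exact hreach
  | @advance t ptr wit a b x h ha hb hV hx ih =>
    intro i hi
    rcases eq_or_ne i a with rfl | hia
    · obtain ⟨y, hy, hreach_y⟩ := hV.exists_nxt ha hb hO hN (h.ptr_lt hO hN h₀) hs ih
      obtain rfl : x = y := by omega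
      simpa using hreach_y
    · simpa [hia] using ih i hi

end PointerRun

/-! ## Augmenting a chain cover -/

/-- All pairs of different pointers shall stand at incomparable elements. -/
def DemandsAntichain (con : ℕ → ℕ) (m : ℕ) : Prop :=
  ∀ a < m, ∀ b < m, con (a * m + b) = if a = b then 2 else 0

/-- `x` lies below its witness `wit x`, whose predecessor in the chains, if there is one, has a
positive rank smaller than that of `x`. -/
structure IsTrailStep (tab : ℕ → ℕ → ℕ) (prv wit rank : ℕ → ℕ) (v x : ℕ) : Prop where
  lt : wit x < v
  le : tab x (wit x) = 1
  ne : x ≠ wit x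
  descend : ∀ z, prv (wit x) = z + 1 → 0 < rank z ∧ rank z < rank x

/-- The state of the search for an antichain after `t` advances of the pointers. An element has a
positive `rank` if a pointer has left it, namely the number of the advance that did. -/
structure AntichainSearch (tab : ℕ → ℕ → ℕ) (prv : ℕ → ℕ) (v m t : ℕ) (ptr wit rank : ℕ → ℕ) :
    Prop where
  ptr_lt : ∀ i < m, ptr i < v
  ptr_inj : ∀ i < m, ∀ j < m, ptr i = ptr j → i = j
  rank_ptr : ∀ i < m, rank (ptr i) = 0
  rank_le : ∀ x, rank x ≤ t
  trail : ∀ x < v, 0 < rank x → IsTrailStep tab prv wit rank v x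
  before_ptr : ∀ i < m, ∀ z, prv (ptr i) = z + 1 → 0 < rank z
  before_left : ∀ x < v, 0 < rank x → ∀ z, prv x = z + 1 → 0 < rank z

/-- The element `cur` has no successor in the chains, and the alternating trail that starts at `cur`
and follows `wit` upwards and `prv` downwards ends at the least element of a chain. -/
structure AugmentingTrail (tab : ℕ → ℕ → ℕ) (prv wit rank : ℕ → ℕ) (v cur : ℕ) : Prop where
  matching : IsMatching tab prv v
  lt : cur < v
  rank_pos : 0 < rank cur
  free : ∀ y < v, prv y ≠ cur + 1
  trail : ∀ x < v, 0 < rank x → rank x ≤ rank cur → IsTrailStep tab prv wit rank v x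

section Augmenting

variable {con : ℕ → ℕ} {tab : ℕ → ℕ → ℕ} {prv nxt head ptr ptr₀ wit wit₀ rank : ℕ → ℕ}
  {a b m n t v w cur x z : ℕ}

theorem Violated.ne_and_le (h : Violated con m tab ptr a b) (hcon : DemandsAntichain con m)
    (ha : a < m) (hb : b < m) : a ≠ b ∧ tab (ptr a) (ptr b) = 1 := by
  rcases h with ⟨h0, hle⟩ | ⟨h1, -⟩
  · refine ⟨?_, hle⟩
    rintro rfl
    simp [hcon a ha a ha] at h0
  · rw [hcon b hb a ha] at h1
    split at h1 <;> omega

theorem WidthLE.le_of_allHold (hW : WidthLE tab n w) (hcon : DemandsAntichain con m)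
    (hptr : ∀ i < m, ptr i < n) (hA : AllHold con m tab ptr) : m ≤ w :=
  hW m ptr hptr fun i hi j hj hij hle => hA i hi j hj (by rw [hcon i hi j hj, if_neg hij, hle])

theorem IsChainData.antichainSearch_start (hC : IsChainData prv nxt head v m)
    (hptr : ∀ i < m, ptr i = head i) : AntichainSearch tab prv v m 0 ptr wit 0 where
  ptr_lt i hi := hptr i hi ▸ hC.head_lt hi
  ptr_inj i hi j hj hij := by
    rw [hptr i hi, hptr j hj] at hij
    exact hC.bijOn_head.injOn hi hj hij
  rank_ptr _ _ := rfl
  rank_le _ := Nat.zero_le _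
  trail _ _ h := absurd h (lt_irrefl 0)
  before_ptr i hi z hz := by rw [hptr i hi, hC.prv_head hi] at hz; omega
  before_left _ _ h := absurd h (lt_irrefl 0)

theorem AntichainSearch.trail_update (h : AntichainSearch tab prv v m t ptr wit rank)
    (ha : a < m) (hb : b < m) (hab : a ≠ b) (hle : tab (ptr a) (ptr b) = 1) (hx : x < v)
    (hrank : 0 < Function.update rank (ptr a) (t + 1) x) :
    IsTrailStep tab prv (Function.update wit (ptr a) (ptr b))
      (Function.update rank (ptr a) (t + 1)) v x := by
  have unranked {z : ℕ} (hz : 0 < rank z) : z ≠ ptr a := by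
    rintro rfl
    exact hz.ne' (h.rank_ptr a ha)
  rcases eq_or_ne x (ptr a) with rfl | hxa
  · have hne : ptr a ≠ ptr b := fun e => hab (h.ptr_inj a ha b hb e)
    refine ⟨by simpa using h.ptr_lt b hb, by simpa using hle, by simpa using hne, fun z hz => ?_⟩
    have hz : 0 < rank z := h.before_ptr b hb z (by simpa using hz)
    simpa [unranked hz] using ⟨hz, h.rank_le z⟩
  · have hold := h.trail x hx (by simpa [hxa] using hrank)
    refine ⟨by simpa [hxa] using hold.lt, by simpa [hxa] using hold.le,
      by simpa [hxa] using hold.ne, fun z hz => ?_⟩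
    have hz := hold.descend z (by simpa [hxa] using hz)
    simpa [hxa, unranked hz.1] using hz

theorem AntichainSearch.advance (h : AntichainSearch tab prv v m t ptr wit rank)
    (hM : IsMatching tab prv v) (hC : IsChainData prv nxt head v m) (ha : a < m) (hb : b < m)
    (hab : a ≠ b) (hle : tab (ptr a) (ptr b) = 1) (hx : nxt (ptr a) = x + 1) :
    AntichainSearch tab prv v m (t + 1) (Function.update ptr a x)
      (Function.update wit (ptr a) (ptr b)) (Function.update rank (ptr a) (t + 1)) := by
  obtain ⟨hxv, hpx⟩ := hC.prv_of_nxt _ (h.ptr_lt a ha) x hx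
  have hne : x ≠ ptr a := (hM.edge x hxv _ hpx).2.2.symm
  have rank_mono {z : ℕ} (hz : 0 < rank z) : 0 < Function.update rank (ptr a) (t + 1) z := by
    by_cases e : z = ptr a <;> simp [e, hz]
  have hx_unranked : rank x = 0 := by
    by_contra hpos
    exact (h.before_left x hxv (Nat.pos_of_ne_zero hpos) _ hpx).ne' (h.rank_ptr a ha)
  have hx_ptr : ∀ j < m, x ≠ ptr j := by
    rintro j hj rfl
    exact (h.before_ptr j hj _ hpx).ne' (h.rank_ptr a ha)
  refine ⟨fun i hi => ?_, fun i hi j hj hij => ?_, fun i hi => ?_, fun z => ?_,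
    fun z hz => h.trail_update ha hb hab hle hz, fun i hi z hz => ?_, fun y hy hpos z hz => ?_⟩
  · by_cases e : i = a
    · simpa [e] using hxv
    · simpa [e] using h.ptr_lt i hi
  · by_cases e : i = a <;> by_cases e' : j = a
    · rw [e, e']
    · exact absurd (by simpa [e, e'] using hij) (hx_ptr j hj)
    · exact absurd (by simpa [e, e'] using hij.symm) (hx_ptr i hi)
    · exact h.ptr_inj i hi j hj (by simpa [e, e'] using hij)
  · by_cases e : i = a
    · simpa [e, hne] using hx_unranked
    · have hia : ptr i ≠ ptr a := fun e' => e (h.ptr_inj i hi a ha e')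
      simpa [e, hia] using h.rank_ptr i hi
  · by_cases e : z = ptr a
    · simp [e]
    · simpa [e] using (h.rank_le z).trans t.le_succ
  · by_cases e : i = a
    · obtain rfl : ptr a = z := by simpa [e, hpx] using hz
      simp
    · exact rank_mono (h.before_ptr i hi z (by simpa [e] using hz))
  · by_cases e : y = ptr a
    · exact rank_mono (h.before_ptr a ha z (e ▸ hz))
    · exact rank_mono (h.before_left y hy (by simpa [e] using hpos) z hz)

theorem PointerRun.antichainSearch (h : PointerRun con m tab nxt ptr₀ wit₀ t ptr wit)
    (hM : IsMatching tab prv v) (hC : IsChainData prv nxt head v m) (hcon : DemandsAntichain con m)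
    (h₀ : ∀ i < m, ptr₀ i = head i) : ∃ rank, AntichainSearch tab prv v m t ptr wit rank := by
  induction h with
  | start => exact ⟨0, hC.antichainSearch_start h₀⟩
  | advance _ ha hb hV hx ih =>
    obtain ⟨rank, hS⟩ := ih
    obtain ⟨hab, hle⟩ := hV.ne_and_le hcon ha hb
    exact ⟨_, hS.advance hM hC ha hb hab hle hx⟩

theorem AntichainSearch.augmentingTrail (h : AntichainSearch tab prv v m t ptr wit rank)
    (hM : IsMatching tab prv v) (hC : IsChainData prv nxt head v m) (ha : a < m) (hb : b < m)
    (hab : a ≠ b) (hle : tab (ptr a) (ptr b) = 1) (hstuck : nxt (ptr a) = 0) :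
    AugmentingTrail tab prv (Function.update wit (ptr a) (ptr b))
      (Function.update rank (ptr a) (t + 1)) v (ptr a) where
  matching := hM
  lt := h.ptr_lt a ha
  rank_pos := by simp
  free y hy hpy := by
    rw [hC.nxt_of_prv y hy _ hpy] at hstuck
    omega
  trail _ hx hpos _ := h.trail_update ha hb hab hle hx hpos

theorem AugmentingTrail.isMatching_update (h : AugmentingTrail tab prv wit rank v cur) :
    IsMatching tab (Function.update prv (wit cur) (cur + 1)) v :=
  have hcur := h.trail cur h.lt h.rank_pos le_rfl
  h.matching.update h.lt hcur.le hcur.ne h.free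

theorem AugmentingTrail.descend (h : AugmentingTrail tab prv wit rank v cur)
    (hz : prv (wit cur) = z + 1) :
    rank z < rank cur ∧
      AugmentingTrail tab (Function.update prv (wit cur) (cur + 1)) wit rank v z := by
  have hcur := h.trail cur h.lt h.rank_pos le_rfl
  obtain ⟨hpos, hlt⟩ := hcur.descend z hz
  refine ⟨hlt, h.isMatching_update, (h.matching.edge _ hcur.lt z hz).1, hpos, fun y hy hpy => ?_,
    fun x hx hx_pos hxz => ?_⟩
  · by_cases e : y = wit cur
    · obtain rfl : cur = z := by simpa [e] using hpy
      exact lt_irrefl _ hlt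
    · exact e (h.matching.inj y hy _ hcur.lt z (by simpa [e] using hpy) hz)
  · have hx_step := h.trail x hx hx_pos (hxz.trans hlt.le)
    have hne : wit x ≠ wit cur := fun e =>
      (hx_step.descend z (e ▸ hz)).2.not_ge hxz
    refine ⟨hx_step.lt, hx_step.le, hx_step.ne, fun u hu => hx_step.descend u ?_⟩
    rwa [Function.update_of_ne hne] at hu

end Augmenting

/-! ## Guesses -/

namespace QFFormula

/-- The truth value of a formula when `x_i ≤ x_j` is read as `M i j` and `x_i = x_j` as
`M i j ∧ M j i`. -/
def Holds {q : ℕ} (M : ℕ → ℕ → Prop) : QFFormula q → Prop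
  | eq i j => M i j ∧ M j i
  | le i j => M i j
  | ne i j => ¬ (M i j ∧ M j i)
  | nle i j => ¬ M i j
  | and ψ₁ ψ₂ => ψ₁.Holds M ∧ ψ₂.Holds M
  | or ψ₁ ψ₂ => ψ₁.Holds M ∨ ψ₂.Holds M

theorem holds_congr {q : ℕ} {M M' : ℕ → ℕ → Prop} (h : ∀ i < q, ∀ j < q, M i j ↔ M' i j)
    (ψ : QFFormula q) : ψ.Holds M ↔ ψ.Holds M' := by
  induction ψ with
  | eq i j => simp only [Holds, h i i.2 j j.2, h j j.2 i i.2]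
  | le i j => simp only [Holds, h i i.2 j j.2]
  | ne i j => simp only [Holds, h i i.2 j j.2, h j j.2 i i.2]
  | nle i j => simp only [Holds, h i i.2 j j.2]
  | and ψ₁ ψ₂ h₁ h₂ => simp only [Holds, h₁, h₂]
  | or ψ₁ ψ₂ h₁ h₂ => simp only [Holds, h₁, h₂]

/-- The formula is satisfied in the poset with order table `tab` on `{0, …, n - 1}`. -/
def SatisfiedIn {q : ℕ} (ψ : QFFormula q) (tab : ℕ → ℕ → ℕ) (n : ℕ) : Prop :=
  ∃ s : ℕ → ℕ, (∀ i < q, s i < n) ∧ ψ.Holds fun i j => tab (s i) (s j) = 1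

end QFFormula

/-- The binary digit of `g` at position `p`. -/
def digit (g p : ℕ) : ℕ := g / 2 ^ p % 2

/-- The number `q * q + q * k` of binary digits of a guess is used as follows: the first `q * q`
digits are the order table of the solution `s`, and the other ones are a `q × k`-matrix that shows
the chain `c i` in which `s i` lies. -/
structure CodesSolution {q : ℕ} (ψ : QFFormula q) (tab : ℕ → ℕ → ℕ) (nxt head : ℕ → ℕ) (n k : ℕ)
    (con s c : ℕ → ℕ) : Prop where
  lt : ∀ i < q, s i < n
  holds : ψ.Holds fun i j => tab (s i) (s j) = 1
  chainReach : ∀ i < q, c i < k ∧ ChainReach nxt (head (c i)) (s i)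
  con_order : ∀ a < q, ∀ b < q, con (a * q + b) = tab (s a) (s b)
  con_chain : ∀ i < q, ∀ j < k, con (q * q + (i * k + j)) ≠ 0 ↔ j = c i

/-- The digits `con` code a solution; see `CodesSolution`. -/
def GoodGuess {q : ℕ} (ψ : QFFormula q) (tab : ℕ → ℕ → ℕ) (nxt head : ℕ → ℕ) (n k : ℕ)
    (con : ℕ → ℕ) : Prop :=
  ∃ s c, CodesSolution ψ tab nxt head n k con s c

/-- All pointers stand at elements of the poset, and if exactly one chain is guessed for a pointer,
then it stands at the head of this chain, as far as the first `r` entries of the matrix of chains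
have been considered. -/
structure Placed (q n k : ℕ) (con head : ℕ → ℕ) (r : ℕ) (ptr : ℕ → ℕ) : Prop where
  lt : ∀ i < q, ptr i < n
  eq_head : ∀ i < q, ∀ d < k, i * k + d < r →
    (∀ j < k, con (q * q + (i * k + j)) ≠ 0 ↔ j = d) → ptr i = head d

section Guess

variable {q n k t a b : ℕ} {ψ : QFFormula q} {tab : ℕ → ℕ → ℕ}
  {prv nxt head con ptr ptr₀ wit wit₀ s c : ℕ → ℕ}

theorem mul_add_lt_mul {a b q m : ℕ} (ha : a < m) (hb : b < q) : a * q + b < m * q := by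
  rw [Nat.mul_comm a]
  exact Nat.mul_add_lt_mul_of_lt_of_lt ha hb

theorem mul_add_div_of_lt {a b q : ℕ} (hb : b < q) : (a * q + b) / q = a := by
  rw [Nat.mul_comm, Nat.mul_add_div (by omega), Nat.div_eq_of_lt hb, Nat.add_zero]

theorem mul_add_inj {m a b c d : ℕ} (hb : b < m) (hd : d < m) (h : a * m + b = c * m + d) :
    a = c ∧ b = d := by
  have hac : a = c := by
    rw [← mul_add_div_of_lt (a := a) hb, h, mul_add_div_of_lt hd]
  subst hac
  exact ⟨rfl, Nat.add_left_cancel h⟩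

theorem digit_ofBits {d : ℕ} (f : Fin d → Bool) {p : ℕ} (hp : p < d) :
    digit (Nat.ofBits f) p = (f ⟨p, hp⟩).toNat := by
  rw [← Nat.testBit_ofBits_lt f p hp, Nat.toNat_testBit, digit]

theorem exists_goodGuess (hO : IsOrderTable tab n) (hM : IsMatching tab prv n)
    (hC : IsChainData prv nxt head n k) (h : ψ.SatisfiedIn tab n) :
    ∃ g < 2 ^ (q * q + q * k), ∀ con, (∀ p < q * q + q * k, con p = digit g p) →
      GoodGuess ψ tab nxt head n k con := by
  obtain ⟨s, hs, hψ⟩ := h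
  have hchain (i : ℕ) : ∃ j, i < q → j < k ∧ ChainReach nxt (head j) (s i) := by
    by_cases hi : i < q
    · obtain ⟨j, hj⟩ := hC.exists_chainReach hO hM (hs i hi)
      exact ⟨j, fun _ => hj⟩
    · exact ⟨0, fun h => absurd h hi⟩
  choose c hc using hchain
  let f : Fin (q * q + q * k) → Bool := fun p =>
    if (p : ℕ) < q * q then decide (tab (s (p / q)) (s (p % q)) = 1)
    else decide ((p - q * q) % k = c ((p - q * q) / k))
  refine ⟨Nat.ofBits f, Nat.ofBits_lt_two_pow f, fun con hcon => ⟨s, c, hs, hψ, hc,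
    fun a ha b hb => ?_, fun i hi j hj => ?_⟩⟩
  · have hlt := mul_add_lt_mul ha hb
    rw [hcon _ (by omega), digit_ofBits f (by omega)]
    simp only [f, hlt, if_true, mul_add_div_of_lt hb, Nat.mul_add_mod_of_lt hb]
    have hle := hO.le_one _ (hs a ha) _ (hs b hb)
    interval_cases tab (s a) (s b) <;> rfl
  · have hlt := mul_add_lt_mul hi hj
    rw [hcon _ (by omega), digit_ofBits f (by omega)]
    simp [f, mul_add_div_of_lt hj, Nat.mul_add_mod_of_lt hj]

theorem CodesSolution.holds_con (h : CodesSolution ψ tab nxt head n k con s c)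
    (hO : IsOrderTable tab n) : ψ.Holds fun i j => con (i * q + j) ≠ 0 := by
  refine (QFFormula.holds_congr (fun i hi j hj => ?_) ψ).1 h.holds
  have := hO.le_one _ (h.lt i hi) _ (h.lt j hj)
  rw [h.con_order i hi j hj]
  omega

theorem Placed.skip (h : Placed q n k con head (a * k + b) ptr) (hb : b < k)
    (h0 : con (q * q + (a * k + b)) = 0) : Placed q n k con head (a * k + b + 1) ptr := by
  refine ⟨h.lt, fun i hi d hd hlt hu => ?_⟩
  rcases Nat.lt_succ_iff_lt_or_eq.1 hlt with hlt | heq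
  · exact h.eq_head i hi d hd hlt hu
  · obtain ⟨rfl, rfl⟩ := mul_add_inj hd hb heq
    exact absurd h0 ((hu d hd).2 rfl)

theorem Placed.update (h : Placed q n k con head (a * k + b) ptr) (hb : b < k)
    (hhead : head b < n) (h1 : con (q * q + (a * k + b)) ≠ 0) :
    Placed q n k con head (a * k + b + 1) (Function.update ptr a (head b)) := by
  refine ⟨fun i hi => ?_, fun i hi d hd hlt hu => ?_⟩
  · rcases eq_or_ne i a with rfl | hia
    · rwa [Function.update_self]
    · exact Function.update_of_ne hia .. ▸ h.lt i hi
  · rcases eq_or_ne i a with rfl | hia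
    · rw [Function.update_self, (hu b hb).1 h1]
    · rw [Function.update_of_ne hia]
      refine h.eq_head i hi d hd (lt_of_le_of_ne (Nat.le_of_lt_succ hlt) fun heq => ?_) hu
      exact hia (mul_add_inj hd hb heq).1

theorem GoodGuess.exists_nxt (h : GoodGuess ψ tab nxt head n k con) (hO : IsOrderTable tab n)
    (hN : Ascends tab nxt n) (hP : Placed q n k con head (q * k) ptr₀)
    (hR : PointerRun con q tab nxt ptr₀ wit₀ t ptr wit) (ha : a < q) (hb : b < q)
    (hV : Violated con q tab ptr a b) : ∃ x, nxt (ptr a) = x + 1 := by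
  obtain ⟨s, c, h⟩ := h
  have hreach : ∀ i < q, ChainReach nxt (ptr₀ i) (s i) := fun i hi => by
    obtain ⟨hci, hr⟩ := h.chainReach i hi
    rwa [hP.eq_head i hi (c i) hci (mul_add_lt_mul hi hci) (h.con_chain i hi)]
  obtain ⟨x, hx, -⟩ := hV.exists_nxt ha hb hO hN (hR.ptr_lt hO hN hP.lt) h.con_order
    (hR.chainReach_solution hO hN hP.lt h.con_order hreach)
  exact ⟨x, hx⟩

theorem satisfiedIn_of_allHold (hO : IsOrderTable tab n) (hptr : ∀ i < q, ptr i < n)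
    (hcon : ∀ p < q * q, con p ≤ 1) (hA : AllHold con q tab ptr)
    (hψ : ψ.Holds fun i j => con (i * q + j) ≠ 0) : ψ.SatisfiedIn tab n := by
  refine ⟨ptr, hptr, (QFFormula.holds_congr (fun i hi j hj => ?_) ψ).1 hψ⟩
  have h₁ := hA i hi j hj
  have h₂ := hO.le_one _ (hptr i hi) _ (hptr j hj)
  have h₃ := hcon _ (mul_add_lt_mul hi hj)
  omega

end Guess

/-! ## A structured language and its compilation -/

/-- The variables of structured programs. -/
inductive Var : Type
  | res | n | q | len | k | m | v | i | j | idx | acc | found | fi | fj | fail | last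
  | finish | cur | elt | tgt | bits | guess | size | pos | sp | tok | val | hi | qq
  deriving DecidableEq

/-- The arrays of structured programs. -/
inductive Arr : Type
  | inp | row | prv | nxt | wit | head | ptr | con | stk | qrow
  deriving DecidableEq

/-- Numbering of the variables, which determines their registers. -/
def Var.code : Var → ℕ
  | res => 0 | n => 1 | q => 2 | len => 3 | k => 4 | m => 5 | v => 6 | i => 7 | j => 8
  | idx => 9 | acc => 10 | found => 11 | fi => 12 | fj => 13 | fail => 14 | last => 15
  | finish => 16 | cur => 17 | elt => 18 | tgt => 19 | bits => 20 | guess => 21 | size => 22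
  | pos => 23 | sp => 24 | tok => 25 | val => 26 | hi => 27 | qq => 28

theorem Var.code_injective : Function.Injective Var.code := by
  intro a b h
  cases a <;> cases b <;> first | rfl | exact absurd h (by decide)

/-- Numbering of the arrays, which determines their memory cells. -/
def Arr.code : Arr → ℕ
  | inp => 0 | row => 1 | prv => 2 | nxt => 3 | wit => 4 | head => 5 | ptr => 6 | con => 7
  | stk => 8 | qrow => 9

theorem Arr.code_injective : Function.Injective Arr.code := by
  intro a b h
  cases a <;> cases b <;> first | rfl | exact absurd h (by decide)

theorem Arr.code_lt (r : Arr) : r.code < 16 := by cases r <;> decide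

/-- States of structured programs: the values of the variables, and the memory. -/
structure PState : Type where
  var : Var → ℕ
  mem : ℕ → ℕ

namespace PState

/-- The contents of an array. The array `r` occupies the memory cells that are congruent to
`r.code` modulo `16`, so that no array needs a bound for its length. -/
def arr (σ : PState) (r : Arr) (i : ℕ) : ℕ := σ.mem (16 * i + r.code)

/-- Assignment to a variable. -/
def setVar (σ : PState) (x : Var) (c : ℕ) : PState := ⟨Function.update σ.var x c, σ.mem⟩

/-- Assignment to an array cell. -/
def setArr (σ : PState) (r : Arr) (i c : ℕ) : PState :=
  ⟨σ.var, Function.update σ.mem (16 * i + r.code) c⟩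

@[simp] theorem setVar_var (σ : PState) (x y : Var) (c : ℕ) :
    (σ.setVar x c).var y = if y = x then c else σ.var y :=
  Function.update_apply ..

@[simp] theorem setVar_arr (σ : PState) (x : Var) (c : ℕ) (r : Arr) :
    (σ.setVar x c).arr r = σ.arr r := rfl

@[simp] theorem setVar_mem (σ : PState) (x : Var) (c : ℕ) : (σ.setVar x c).mem = σ.mem := rfl

@[simp] theorem setArr_var (σ : PState) (r : Arr) (i c : ℕ) : (σ.setArr r i c).var = σ.var := rfl

@[simp] theorem setArr_arr (σ : PState) (r r' : Arr) (i c : ℕ) :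
    (σ.setArr r i c).arr r' = if r' = r then Function.update (σ.arr r) i c else σ.arr r' := by
  funext j
  have hr := r.code_lt
  have hr' := r'.code_lt
  by_cases h : r' = r
  · subst h
    by_cases hj : j = i
    · simp [arr, setArr, hj]
    · simp [arr, setArr, hj]
  · have hcode : r'.code ≠ r.code := fun e => h (Arr.code_injective e)
    have hcell : 16 * j + r'.code ≠ 16 * i + r.code := by lia
    simp [arr, setArr, h, hcell]

end PState

/-- Expressions; `get r a` reads an array, `raw a` reads a memory cell. -/
inductive PExpr : Type
  | const (c : ℕ)
  | var (x : Var)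
  | add (a b : PExpr)
  | sub (a b : PExpr)
  | half (a : PExpr)
  | get (r : Arr) (a : PExpr)
  | raw (a : PExpr)

namespace PExpr

/-- The value of an expression. -/
def eval (σ : PState) : PExpr → ℕ
  | const c => c
  | var x => σ.var x
  | add a b => a.eval σ + b.eval σ
  | sub a b => a.eval σ - b.eval σ
  | half a => a.eval σ / 2
  | get r a => σ.arr r (a.eval σ)
  | raw a => σ.mem (a.eval σ)

/-- The number of machine instructions that evaluate the expression. -/
def cost : PExpr → ℕ
  | const _ => 1
  | var _ => 1
  | add a b => a.cost + b.cost + 1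
  | sub a b => a.cost + b.cost + 1
  | half a => a.cost + 1
  | get _ a => a.cost + 7
  | raw a => a.cost + 1

end PExpr

/-- Statements. -/
inductive PStmt : Type
  | skip
  | set (x : Var) (e : PExpr)
  | put (r : Arr) (i e : PExpr)
  | seq (s t : PStmt)
  | ite (e : PExpr) (s t : PStmt)
  | loop (e : PExpr) (s : PStmt)

namespace PStmt

/-- The effect of a statement. `loop e s` repeats `s` as often as the initial value of `e` says,
so every program terminates; `ite e s t` tests whether `e` is nonzero. -/
def run : PStmt → PState → PState
  | skip, σ => σ
  | set x e, σ => σ.setVar x (e.eval σ)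
  | put r i e, σ => σ.setArr r (i.eval σ) (e.eval σ)
  | seq s t, σ => t.run (s.run σ)
  | ite e s t, σ => if e.eval σ = 0 then t.run σ else s.run σ
  | loop e s, σ => s.run^[e.eval σ] σ

/-- The number of machine steps that a statement takes. -/
def cost : PStmt → PState → ℕ
  | skip, _ => 0
  | set _ e, _ => e.cost + 1
  | put _ i e, _ => i.cost + e.cost + 7
  | seq s t, σ => s.cost σ + t.cost (s.run σ)
  | ite e s t, σ => e.cost + if e.eval σ = 0 then 1 + t.cost σ else 2 + s.cost σ
  | loop e s, σ => e.cost + 2 + ∑ r ∈ Finset.range (e.eval σ), (s.cost (s.run^[r] σ) + 4)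

end PStmt

/-- The register of a program variable. -/
def varReg (x : Var) : ℕ := 3 * x.code

/-- The registers for intermediate results. -/
def tmpReg (d : ℕ) : ℕ := 3 * d + 1

/-- The registers for loop counters. -/
def cntReg (d : ℕ) : ℕ := 3 * d + 2

theorem varReg_ne_tmpReg (x : Var) (d : ℕ) : varReg x ≠ tmpReg d := by
  simp only [varReg, tmpReg]; lia

theorem cntReg_ne_tmpReg (k d : ℕ) : cntReg k ≠ tmpReg d := by
  simp only [cntReg, tmpReg]; lia

theorem varReg_ne_cntReg (x : Var) (d : ℕ) : varReg x ≠ cntReg d := by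
  simp only [varReg, cntReg]; lia

theorem varReg_inj {x y : Var} : varReg x = varReg y ↔ x = y :=
  ⟨fun h => Var.code_injective (by simp only [varReg] at h; lia), fun h => h ▸ rfl⟩

theorem tmpReg_inj {a b : ℕ} : tmpReg a = tmpReg b ↔ a = b := by
  simp only [tmpReg]; lia

theorem cntReg_inj {a b : ℕ} : cntReg a = cntReg b ↔ a = b := by
  simp only [cntReg]; lia

/-- Code that replaces `tmpReg d` by the address of cell number `tmpReg d` of the array `r`. -/
def addrCode (r : Arr) (d : ℕ) : RamProg :=
  [.add (tmpReg d) (tmpReg d) (tmpReg d), .add (tmpReg d) (tmpReg d) (tmpReg d),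
   .add (tmpReg d) (tmpReg d) (tmpReg d), .add (tmpReg d) (tmpReg d) (tmpReg d),
   .const (tmpReg (d + 1)) r.code, .add (tmpReg d) (tmpReg d) (tmpReg (d + 1))]

/-- Code that evaluates an expression into `tmpReg d` and only uses `tmpReg d'` for `d' ≥ d`. -/
def PExpr.compile : PExpr → ℕ → RamProg
  | const c, d => [.const (tmpReg d) c]
  | var x, d => [.move (tmpReg d) (varReg x)]
  | add a b, d =>
      a.compile d ++ (b.compile (d + 1) ++ [.add (tmpReg d) (tmpReg d) (tmpReg (d + 1))])
  | sub a b, d =>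
      a.compile d ++ (b.compile (d + 1) ++ [.sub (tmpReg d) (tmpReg d) (tmpReg (d + 1))])
  | half a, d => a.compile d ++ [.half (tmpReg d) (tmpReg d)]
  | get r a, d => a.compile d ++ (addrCode r d ++ [.load (tmpReg d) (tmpReg d)])
  | raw a, d => a.compile d ++ [.load (tmpReg d) (tmpReg d)]

/-- Code for a statement that starts at address `b`, inside `d` loops. -/
def PStmt.compile : PStmt → ℕ → ℕ → RamProg
  | skip, _, _ => []
  | set x e, _, _ => e.compile 0 ++ [.move (varReg x) (tmpReg 0)]
  | put r i e, _, _ => i.compile 0 ++ (addrCode r 0 ++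
      (e.compile 1 ++ [.store (tmpReg 0) (tmpReg 1)]))
  | seq s t, b, d => s.compile b d ++ t.compile (b + (s.compile b d).length) d
  | ite e s t, b, d =>
      let bs := b + e.cost + 1
      let bt := bs + (s.compile bs d).length + 1
      (e.compile 0 ++ [.jzero (tmpReg 0) bt]) ++ (s.compile bs d ++
        ([.jump (bt + (t.compile bt d).length)] ++ t.compile bt d))
  | loop e s, b, d =>
      let l := b + e.cost + 1
      let body := s.compile (l + 3) (d + 1)
      e.compile 0 ++ ([.move (cntReg d) (tmpReg 0)] ++
        ([.jzero (cntReg d) (l + 3 + body.length + 1), .const (tmpReg 0) 1,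
          .sub (cntReg d) (cntReg d) (tmpReg 0)] ++ (body ++ [.jump l])))

/-- The code `l` stands in the program `p` from address `b` on. -/
def CodeAt (p : RamProg) (b : ℕ) (l : RamProg) : Prop :=
  ∀ i, ∀ h : i < l.length, p[b + i]? = some l[i]

theorem CodeAt.append_iff {p : RamProg} {b : ℕ} {l₁ l₂ : RamProg} :
    CodeAt p b (l₁ ++ l₂) ↔ CodeAt p b l₁ ∧ CodeAt p (b + l₁.length) l₂ := by
  constructor
  · refine fun h => ⟨fun i hi => ?_, fun i hi => ?_⟩
    · rw [h i (by rw [List.length_append]; lia), List.getElem_append_left hi]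
    · rw [Nat.add_assoc, h (l₁.length + i) (by rw [List.length_append]; lia),
        List.getElem_append_right (by lia)]
      simp
  · rintro ⟨h₁, h₂⟩ i hi
    by_cases hl : i < l₁.length
    · rw [List.getElem_append_left hl, h₁ i hl]
    · rw [List.length_append] at hi
      rw [List.getElem_append_right (by lia), ← h₂ (i - l₁.length) (by lia)]
      congr 1
      lia

theorem CodeAt.tail {p : RamProg} {b : ℕ} {i : RamInstr} {l : RamProg} (h : CodeAt p b (i :: l)) :
    CodeAt p (b + 1) l :=
  (CodeAt.append_iff (l₁ := [i]).1 h).2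

/-- `p` goes from `c` to `c'` in `t` steps. -/
def Steps (p : RamProg) (c c' : RamConfig) (t : ℕ) : Prop := p.step^[t] c = c'

theorem Steps.trans {p : RamProg} {c c' c'' : RamConfig} {t t' : ℕ} (h : Steps p c c' t)
    (h' : Steps p c' c'' t') : Steps p c c'' (t + t') := by
  rw [Steps, Nat.add_comm, Function.iterate_add_apply, show _ = c' from h]
  exact h'

theorem CodeAt.steps {p : RamProg} {c : RamConfig} {b : ℕ} {i : RamInstr} {l : RamProg}
    (h : CodeAt p b (i :: l)) (hc : c.pc = b) : Steps p c (i.exec c) 1 := by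
  have hi : p[c.pc]? = some i := hc ▸ h 0 (by simp)
  simp [Steps, RamProg.step, hi]

/-- `c'` differs from `c` only in intermediate results from number `d` on, and in the program
counter. -/
structure SameBelow (d : ℕ) (c c' : RamConfig) : Prop where
  reg : ∀ r, (∀ d' ≥ d, r ≠ tmpReg d') → c'.reg r = c.reg r
  mem : c'.mem = c.mem

/-- The machine state `c` represents the program state `σ`. -/
structure Represents (c : RamConfig) (σ : PState) : Prop where
  reg : ∀ x, c.reg (varReg x) = σ.var x
  mem : c.mem = σ.mem

namespace SameBelow

variable {d d' : ℕ} {c c' c'' : RamConfig}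

theorem trans (h : SameBelow d c c') (h' : SameBelow d c' c'') : SameBelow d c c'' :=
  ⟨fun r hr => (h'.reg r hr).trans (h.reg r hr), h'.mem.trans h.mem⟩

theorem mono (hd : d' ≤ d) (h : SameBelow d c c') : SameBelow d' c c' :=
  ⟨fun r hr => h.reg r fun e he => hr e (hd.trans he), h.mem⟩

theorem update (c : RamConfig) (pc d v : ℕ) :
    SameBelow d c ⟨pc, Function.update c.reg (tmpReg d) v, c.mem⟩ :=
  ⟨fun _ hr => Function.update_of_ne (hr d le_rfl) .., rfl⟩

theorem tmp (h : SameBelow d c c') (hd : d' < d) : c'.reg (tmpReg d') = c.reg (tmpReg d') :=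
  h.reg _ fun _ he => by simp only [ne_eq, tmpReg_inj]; lia

theorem cnt (h : SameBelow d c c') (k : ℕ) : c'.reg (cntReg k) = c.reg (cntReg k) :=
  h.reg _ fun _ _ => cntReg_ne_tmpReg _ _

theorem represents {σ : PState} (h : SameBelow d c c') (hc : Represents c σ) : Represents c' σ :=
  ⟨fun x => (h.reg _ fun _ _ => varReg_ne_tmpReg _ _).trans (hc.reg x), h.mem.trans hc.mem⟩

end SameBelow

theorem PExpr.length_compile (e : PExpr) (d : ℕ) : (e.compile d).length = e.cost := by
  induction e generalizing d <;> simp_all [PExpr.compile, PExpr.cost, addrCode] <;> lia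

theorem addrCode_correct {p : RamProg} {b d : ℕ} {r : Arr} {c : RamConfig}
    (h : CodeAt p b (addrCode r d)) (hc : c.pc = b) :
    ∃ c', Steps p c c' 6 ∧ c'.pc = b + 6 ∧ SameBelow d c c' ∧
      c'.reg (tmpReg d) = 16 * c.reg (tmpReg d) + r.code := by
  have hne : tmpReg d ≠ tmpReg (d + 1) := by simp [tmpReg_inj]
  have h₁ := h.tail
  have h₂ := h₁.tail
  have h₃ := h₂.tail
  have h₄ := h₃.tail
  refine ⟨_, (((((h.steps hc).trans (h₁.steps ?_)).trans (h₂.steps ?_)).trans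
    (h₃.steps ?_)).trans (h₄.steps ?_)).trans (h₄.tail.steps ?_), ?_, ⟨?_, ?_⟩, ?_⟩
  case refine_7 => exact fun s hs => by simp [RamInstr.exec, hs d le_rfl, hs (d + 1) (by lia)]
  case refine_9 =>
    simp only [RamInstr.exec, Function.update_apply, hne, if_true, if_false]
    ring
  all_goals simp [RamInstr.exec, hc]

theorem PExpr.compile_correct (e : PExpr) {p : RamProg} {b d : ℕ} {c : RamConfig} {σ : PState}
    (h : CodeAt p b (e.compile d)) (hc : c.pc = b) (hr : Represents c σ) :
    ∃ c', Steps p c c' e.cost ∧ c'.pc = b + e.cost ∧ SameBelow d c c' ∧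
      c'.reg (tmpReg d) = e.eval σ := by
  have pc {b : ℕ} {e : PExpr} {c : RamConfig} (h : c.pc = b + e.cost) :
      c.pc + 1 = b + (e.cost + 1) := by lia
  induction e generalizing b d c with
  | const _ =>
    exact ⟨_, h.steps hc, congrArg (· + 1) hc, .update .., by simp [RamInstr.exec, eval]⟩
  | var _ =>
    exact ⟨_, h.steps hc, congrArg (· + 1) hc, .update .., by simp [RamInstr.exec, eval, hr.reg]⟩
  | half a ih =>
    simp only [compile, CodeAt.append_iff, length_compile] at h
    obtain ⟨c₁, s₁, p₁, f₁, r₁⟩ := ih h.1 hc hr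
    exact ⟨_, s₁.trans (h.2.steps p₁), pc p₁, f₁.trans (.update ..),
      by simp [RamInstr.exec, eval, r₁]⟩
  | raw a ih =>
    simp only [compile, CodeAt.append_iff, length_compile] at h
    obtain ⟨c₁, s₁, p₁, f₁, r₁⟩ := ih h.1 hc hr
    exact ⟨_, s₁.trans (h.2.steps p₁), pc p₁, f₁.trans (.update ..),
      by simp [RamInstr.exec, eval, r₁, (f₁.represents hr).mem]⟩
  | get r a ih =>
    simp only [compile, CodeAt.append_iff, length_compile] at h
    obtain ⟨c₁, s₁, p₁, f₁, r₁⟩ := ih h.1 hc hr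
    obtain ⟨c₂, s₂, p₂, f₂, r₂⟩ := addrCode_correct h.2.1 p₁
    exact ⟨_, (s₁.trans s₂).trans (h.2.2.steps p₂), by simp [RamInstr.exec, p₂, cost, add_assoc],
      (f₁.trans f₂).trans (.update ..),
      by simp [RamInstr.exec, eval, r₂, r₁, (f₂.represents (f₁.represents hr)).mem, PState.arr]⟩
  | add a a' iha iha' =>
    simp only [compile, CodeAt.append_iff, length_compile] at h
    obtain ⟨c₁, s₁, p₁, f₁, r₁⟩ := iha h.1 hc hr
    obtain ⟨c₂, s₂, p₂, f₂, r₂⟩ := iha' h.2.1 p₁ (f₁.represents hr)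
    exact ⟨_, (s₁.trans s₂).trans (h.2.2.steps p₂), by simp [RamInstr.exec, p₂, cost, add_assoc],
      (f₁.trans (f₂.mono d.le_succ)).trans (.update ..),
      by simp [RamInstr.exec, eval, r₂, r₁, f₂.tmp d.lt_succ_self]⟩
  | sub a a' iha iha' =>
    simp only [compile, CodeAt.append_iff, length_compile] at h
    obtain ⟨c₁, s₁, p₁, f₁, r₁⟩ := iha h.1 hc hr
    obtain ⟨c₂, s₂, p₂, f₂, r₂⟩ := iha' h.2.1 p₁ (f₁.represents hr)
    exact ⟨_, (s₁.trans s₂).trans (h.2.2.steps p₂), by simp [RamInstr.exec, p₂, cost, add_assoc],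
      (f₁.trans (f₂.mono d.le_succ)).trans (.update ..),
      by simp [RamInstr.exec, eval, r₂, r₁, f₂.tmp d.lt_succ_self]⟩

/-- Between the addresses `b` and `b'`, the program `p` takes `t` steps to transform the program
state `σ` into `τ`; it leaves the counters of the `d` enclosing loops unchanged. -/
def Simulates (p : RamProg) (d b : ℕ) (σ : PState) (b' : ℕ) (τ : PState) (t : ℕ) : Prop :=
  ∀ c : RamConfig, c.pc = b → Represents c σ → ∃ c', Steps p c c' t ∧ c'.pc = b' ∧
    Represents c' τ ∧ ∀ k < d, c'.reg (cntReg k) = c.reg (cntReg k)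

namespace Simulates

variable {p : RamProg} {d b b' b'' : ℕ} {σ τ υ : PState} {t t' : ℕ}

theorem trans (h : Simulates p d b σ b' τ t) (h' : Simulates p d b' τ b'' υ t') :
    Simulates p d b σ b'' υ (t + t') := by
  intro c hc hr
  obtain ⟨c₁, s₁, p₁, r₁, k₁⟩ := h c hc hr
  obtain ⟨c₂, s₂, p₂, r₂, k₂⟩ := h' c₁ p₁ r₁
  exact ⟨c₂, s₁.trans s₂, p₂, r₂, fun k hk => (k₂ k hk).trans (k₁ k hk)⟩

theorem congr (h : Simulates p d b σ b' τ t) (hb : b' = b'') (ht : t = t') :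
    Simulates p d b σ b'' τ t' :=
  hb ▸ ht ▸ h

theorem jump {l : RamProg} (h : CodeAt p b (.jump b' :: l)) : Simulates p d b σ b' σ 1 :=
  fun _ hc hr => ⟨_, h.steps hc, rfl, ⟨hr.reg, hr.mem⟩, fun _ _ => rfl⟩

theorem branch {e : PExpr} (h : CodeAt p b (e.compile 0 ++ [.jzero (tmpReg 0) b'])) :
    Simulates p d b σ (if e.eval σ = 0 then b' else b + e.cost + 1) σ (e.cost + 1) := by
  intro c hc hr
  simp only [CodeAt.append_iff, PExpr.length_compile] at h
  obtain ⟨c₁, s₁, p₁, f₁, r₁⟩ := e.compile_correct h.1 hc hr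
  have hr₁ := f₁.represents hr
  exact ⟨_, s₁.trans (h.2.steps p₁), by simp [RamInstr.exec, p₁, r₁], ⟨hr₁.reg, hr₁.mem⟩,
    fun k _ => f₁.cnt k⟩

theorem set {x : Var} {e : PExpr} (h : CodeAt p b ((PStmt.set x e).compile b d)) :
    Simulates p d b σ (b + (e.cost + 1)) (σ.setVar x (e.eval σ)) (e.cost + 1) := by
  intro c hc hr
  simp only [PStmt.compile, CodeAt.append_iff, PExpr.length_compile] at h
  obtain ⟨c₁, s₁, p₁, f₁, r₁⟩ := e.compile_correct h.1 hc hr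
  have hr₁ := f₁.represents hr
  refine ⟨_, s₁.trans (h.2.steps p₁), by simp [RamInstr.exec, p₁, add_assoc],
    ⟨fun y => ?_, hr₁.mem⟩, fun k _ => ?_⟩
  · simp [RamInstr.exec, Function.update_apply, varReg_inj, r₁, hr₁.reg]
  · simp [RamInstr.exec, (varReg_ne_cntReg x k).symm, f₁.cnt]

theorem put {r : Arr} {i e : PExpr} (h : CodeAt p b ((PStmt.put r i e).compile b d)) :
    Simulates p d b σ (b + (i.cost + e.cost + 7)) (σ.setArr r (i.eval σ) (e.eval σ))
      (i.cost + e.cost + 7) := by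
  intro c hc hr
  simp only [PStmt.compile, CodeAt.append_iff, PExpr.length_compile] at h
  obtain ⟨c₁, s₁, p₁, f₁, r₁⟩ := i.compile_correct h.1 hc hr
  obtain ⟨c₂, s₂, p₂, f₂, r₂⟩ := addrCode_correct h.2.1 p₁
  have hr₂ := f₂.represents (f₁.represents hr)
  obtain ⟨c₃, s₃, p₃, f₃, r₃⟩ := e.compile_correct h.2.2.1 p₂ hr₂
  have hr₃ := f₃.represents hr₂
  have hcost : i.cost + e.cost + 7 = i.cost + 6 + e.cost + 1 := by ring
  have hlen : (addrCode r 0).length = 6 := rfl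
  rw [hcost]
  refine ⟨_, ((s₁.trans s₂).trans s₃).trans (h.2.2.2.steps p₃), ?_, ⟨hr₃.reg, ?_⟩, fun k _ => ?_⟩
  · simp only [RamInstr.exec, p₃]
    lia
  · simp [RamInstr.exec, hr₃.mem, PState.setArr, f₃.tmp Nat.zero_lt_one, r₃, r₂, r₁]
  · simp [RamInstr.exec, f₃.cnt, f₂.cnt, f₁.cnt]

variable {e : PExpr} {s : PStmt}

theorem ite {t : PStmt} (h : CodeAt p b ((PStmt.ite e s t).compile b d))
    (hs : ∀ b, CodeAt p b (s.compile b d) →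
      Simulates p d b σ (b + (s.compile b d).length) (s.run σ) (s.cost σ))
    (ht : ∀ b, CodeAt p b (t.compile b d) →
      Simulates p d b σ (b + (t.compile b d).length) (t.run σ) (t.cost σ)) :
    Simulates p d b σ (b + ((PStmt.ite e s t).compile b d).length) ((PStmt.ite e s t).run σ)
      ((PStmt.ite e s t).cost σ) := by
  simp only [PStmt.compile] at h ⊢
  obtain ⟨hbranch, h⟩ := CodeAt.append_iff.1 h
  simp only [CodeAt.append_iff, List.length_append, PExpr.length_compile, List.length_cons,
    List.length_nil, zero_add, ← add_assoc b] at h ⊢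
  obtain ⟨hcs, hjump, hct⟩ := h
  have hb := branch (d := d) (σ := σ) hbranch
  by_cases h0 : e.eval σ = 0
  · simp only [h0, if_true, PStmt.run, PStmt.cost] at hb ⊢
    exact (hb.trans (ht _ hct)).congr (by lia) (by lia)
  · simp only [h0, if_false, PStmt.run, PStmt.cost] at hb ⊢
    exact ((hb.trans (hs _ hcs)).trans (jump hjump)).congr (by lia) (by lia)

theorem iterate {l l' : ℕ} {tl : RamProg}
    (htest : CodeAt p l [.jzero (cntReg d) (l' + 1), .const (tmpReg 0) 1,
      .sub (cntReg d) (cntReg d) (tmpReg 0)])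
    (hjump : CodeAt p l' (.jump l :: tl))
    (hs : ∀ σ, Simulates p (d + 1) (l + 3) σ l' (s.run σ) (s.cost σ)) (N : ℕ) (σ : PState)
    (c : RamConfig) (hc : c.pc = l) (hr : Represents c σ) (hN : c.reg (cntReg d) = N) :
    ∃ c', Steps p c c' (∑ r ∈ Finset.range N, (s.cost (s.run^[r] σ) + 4) + 1) ∧ c'.pc = l' + 1 ∧
      Represents c' (s.run^[N] σ) ∧ ∀ k < d, c'.reg (cntReg k) = c.reg (cntReg k) := by
  induction N generalizing σ c with
  | zero =>
    refine ⟨(RamInstr.jzero (cntReg d) (l' + 1)).exec c, ?_, ?_, ⟨hr.reg, hr.mem⟩, fun _ _ => rfl⟩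
    · rw [Finset.sum_range_zero, zero_add]
      exact htest.steps hc
    · simp [RamInstr.exec, hN]
  | succ N ih =>
    have hsteps := ((htest.steps hc).trans (htest.tail.steps
      (by simp [RamInstr.exec, hN, hc]))).trans (htest.tail.tail.steps
      (by simp [RamInstr.exec, hN, hc]))
    set c₁ := (RamInstr.sub (cntReg d) (cntReg d) (tmpReg 0)).exec
      ((RamInstr.const (tmpReg 0) 1).exec ((RamInstr.jzero (cntReg d) (l' + 1)).exec c)) with hc₁
    have hcnt : ∀ k, c₁.reg (cntReg k) = if k = d then N else c.reg (cntReg k) := fun k => by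
      simp only [hc₁, RamInstr.exec, Function.update_apply, cntReg_inj, cntReg_ne_tmpReg,
        if_false, if_true, hN, Nat.add_sub_cancel]
    have hr₁ : Represents c₁ σ :=
      ⟨fun x => by simp [hc₁, RamInstr.exec, varReg_ne_cntReg, varReg_ne_tmpReg, hr.reg], hr.mem⟩
    obtain ⟨c₂, hsteps₂, hc₂, hr₂, hk₂⟩ := ((hs σ).trans (jump hjump)) c₁
      (by simp [hc₁, RamInstr.exec, hN, hc]) hr₁
    obtain ⟨c₃, hsteps₃, hc₃, hr₃, hk₃⟩ := ih (s.run σ) c₂ hc₂ hr₂ (by simp [hk₂ d, hcnt])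
    refine ⟨c₃, ?_, hc₃, hr₃, fun k hk => ?_⟩
    · convert (hsteps.trans hsteps₂).trans hsteps₃ using 1
      rw [Finset.sum_range_succ']
      simp only [Function.iterate_succ_apply, Function.iterate_zero_apply]
      ring
    · rw [hk₃ k hk, hk₂ k (by lia), hcnt, if_neg hk.ne]

theorem loop (h : CodeAt p b ((PStmt.loop e s).compile b d))
    (hs : ∀ b σ, CodeAt p b (s.compile b (d + 1)) →
      Simulates p (d + 1) b σ (b + (s.compile b (d + 1)).length) (s.run σ) (s.cost σ)) :
    Simulates p d b σ (b + ((PStmt.loop e s).compile b d).length) ((PStmt.loop e s).run σ)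
      ((PStmt.loop e s).cost σ) := by
  intro c hc hr
  simp only [PStmt.compile, CodeAt.append_iff, List.length_append, PExpr.length_compile,
    List.length_cons, List.length_nil, zero_add] at h ⊢
  obtain ⟨he, hmove, htest, hbody, hjump⟩ := h
  obtain ⟨c₁, s₁, p₁, f₁, r₁⟩ := e.compile_correct he hc hr
  have hr₁ := f₁.represents hr
  have hr₂ : Represents ((RamInstr.move (cntReg d) (tmpReg 0)).exec c₁) σ :=
    ⟨fun x => by simp [RamInstr.exec, varReg_ne_cntReg, hr₁.reg], hr₁.mem⟩
  obtain ⟨c₂, s₂, p₂, hr₂, k₂⟩ := iterate htest hjump (fun σ => hs _ σ hbody) (e.eval σ) σ _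
    (by simp [RamInstr.exec, p₁]) hr₂ (by simp [RamInstr.exec, r₁])
  refine ⟨c₂, ?_, by rw [p₂]; lia, hr₂, fun k hk => ?_⟩
  · convert (s₁.trans (hmove.steps p₁)).trans s₂ using 1
    simp only [PStmt.cost]
    lia
  · rw [k₂ k hk]
    simp [RamInstr.exec, cntReg_inj, hk.ne, f₁.cnt]

end Simulates

theorem PStmt.compile_correct (s : PStmt) {p : RamProg} {b d : ℕ} {σ : PState}
    (h : CodeAt p b (s.compile b d)) :
    Simulates p d b σ (b + (s.compile b d).length) (s.run σ) (s.cost σ) := by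
  induction s generalizing b d σ with
  | skip => exact fun c hc hr => ⟨c, rfl, hc, hr, fun _ _ => rfl⟩
  | set _ _ => exact (Simulates.set h).congr (by simp [compile, PExpr.length_compile]) rfl
  | put _ _ _ =>
    refine (Simulates.put h).congr ?_ rfl
    simp only [compile, List.length_append, PExpr.length_compile, addrCode, List.length_cons,
      List.length_nil]
    lia
  | seq s t ihs iht =>
    rw [compile, CodeAt.append_iff] at h
    exact ((ihs h.1).trans (iht h.2)).congr (by simp [compile, add_assoc]) rfl
  | ite _ _ _ ihs iht => exact .ite h (fun _ => ihs) (fun _ => iht)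
  | loop _ _ ih => exact .loop h fun _ _ => ih

/-- The state in which a program is started on input `x`. -/
def PState.start (x : List ℕ) : PState := ⟨fun _ => 0, fun a => x.getD a 0⟩

theorem PStmt.outputsWithin (s : PStmt) (x : List ℕ) {y T : ℕ}
    (hy : (s.run (PState.start x)).var .res = y) (hT : s.cost (PState.start x) ≤ T) :
    RamProg.OutputsWithin (s.compile 0 0) x y T := by
  obtain ⟨c, h₁, h₂, h₃, -⟩ := s.compile_correct (p := s.compile 0 0) (b := 0) (d := 0)
    (fun _ hi => by simp [hi]) (RamProg.init x) rfl (σ := PState.start x) ⟨fun _ => rfl, rfl⟩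
  refine ⟨_, hT, ?_⟩
  rw [show _ = c from h₁]
  exact ⟨by simp [RamProg.Halted, h₂], (h₃.reg .res).trans hy⟩

/-! ## Program specifications -/

namespace PStmt

/-- The variables that a statement may change. -/
def vars : PStmt → List Var
  | skip => []
  | set x _ => [x]
  | put _ _ _ => []
  | seq s t => s.vars ++ t.vars
  | ite _ s t => s.vars ++ t.vars
  | loop _ s => s.vars

/-- The arrays that a statement may change. -/
def arrs : PStmt → List Arr
  | skip => []
  | set _ _ => []
  | put r _ _ => [r]
  | seq s t => s.arrs ++ t.arrs
  | ite _ s t => s.arrs ++ t.arrs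
  | loop _ s => s.arrs

/-- The states `σ` and `τ` agree on everything that the statement `s` does not write to. -/
structure Frame (s : PStmt) (σ τ : PState) : Prop where
  var : ∀ {x}, x ∉ s.vars → τ.var x = σ.var x
  arr : ∀ {r}, r ∉ s.arrs → τ.arr r = σ.arr r

namespace Frame

variable {s t : PStmt} {σ τ υ : PState}

theorem refl (s : PStmt) (σ : PState) : s.Frame σ σ := ⟨fun _ => rfl, fun _ => rfl⟩

theorem trans (h : s.Frame σ τ) (h' : s.Frame τ υ) : s.Frame σ υ :=
  ⟨fun hx => (h'.var hx).trans (h.var hx), fun hr => (h'.arr hr).trans (h.arr hr)⟩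

theorem mono (h : s.Frame σ τ) (hv : s.vars ⊆ t.vars) (ha : s.arrs ⊆ t.arrs) : t.Frame σ τ :=
  ⟨fun hx => h.var fun hs => hx (hv hs), fun hr => h.arr fun hs => hr (ha hs)⟩

theorem setVar {x : Var} (hx : x ∈ s.vars) (σ : PState) (c : ℕ) : s.Frame σ (σ.setVar x c) :=
  ⟨fun hy => by rw [PState.setVar_var, if_neg (ne_of_mem_of_not_mem hx hy).symm], fun _ => rfl⟩

theorem iterate (h : ∀ σ, s.Frame σ (s.run σ)) (N : ℕ) (σ : PState) :
    s.Frame σ (s.run^[N] σ) := by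
  induction N with
  | zero => exact refl s σ
  | succ N ih => exact Function.iterate_succ_apply' .. ▸ ih.trans (h _)

end Frame

theorem frame_run (s : PStmt) (σ : PState) : s.Frame σ (s.run σ) := by
  induction s generalizing σ with
  | skip => exact .refl _ σ
  | set _ _ => exact .setVar (List.mem_singleton.2 rfl) σ _
  | put _ _ _ =>
    exact ⟨fun _ => rfl, fun hr => by
      rw [run, PState.setArr_arr, if_neg fun h => hr (List.mem_singleton.2 h)]⟩
  | seq s t ihs iht =>
    exact ((ihs σ).mono (by simp [vars]) (by simp [arrs])).trans
      ((iht _).mono (by simp [vars]) (by simp [arrs]))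
  | ite e s t ihs iht =>
    rw [run]
    split
    · exact (iht σ).mono (by simp [vars]) (by simp [arrs])
    · exact (ihs σ).mono (by simp [vars]) (by simp [arrs])
  | loop e s ih => exact (Frame.iterate ih _ σ).mono (List.Subset.refl _) (List.Subset.refl _)

/-- From the state `σ`, the statement `s` leads in at most `B` steps to a state with the
property `Q`. -/
def Spec (s : PStmt) (σ : PState) (Q : PState → Prop) (B : ℕ) : Prop :=
  Q (s.run σ) ∧ s.cost σ ≤ B

namespace Spec

variable {s t : PStmt} {e : PExpr} {σ : PState} {Q R : PState → Prop} {B B' N : ℕ}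

theorem mono (h : s.Spec σ Q B) (hQ : ∀ τ, s.Frame σ τ → Q τ → R τ) (hB : B ≤ B') :
    s.Spec σ R B' :=
  ⟨hQ _ (s.frame_run σ) h.1, h.2.trans hB⟩

theorem le (h : s.Spec σ Q B) (hB : B ≤ B') : s.Spec σ Q B' := h.mono (fun _ _ h => h) hB

theorem seq (h : s.Spec σ Q B) (h' : ∀ τ, s.Frame σ τ → Q τ → t.Spec τ R B') :
    (s.seq t).Spec σ R (B + B') :=
  let h₁ := h' _ (s.frame_run σ) h.1
  ⟨h₁.1, Nat.add_le_add h.2 h₁.2⟩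

theorem set_seq {x : Var} (h : t.Spec (σ.setVar x (e.eval σ)) Q B) :
    ((PStmt.set x e).seq t).Spec σ Q (e.cost + 1 + B) :=
  ⟨h.1, Nat.add_le_add_left h.2 _⟩

theorem put_seq {r : Arr} {i : PExpr} (h : t.Spec (σ.setArr r (i.eval σ) (e.eval σ)) Q B) :
    ((PStmt.put r i e).seq t).Spec σ Q (i.cost + e.cost + 7 + B) :=
  ⟨h.1, Nat.add_le_add_left h.2 _⟩

theorem ite (hs : e.eval σ ≠ 0 → s.Spec σ Q B) (ht : e.eval σ = 0 → t.Spec σ Q B) :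
    (PStmt.ite e s t).Spec σ Q (e.cost + 2 + B) := by
  by_cases h : e.eval σ = 0
  · simp only [Spec, run, cost, h, if_true]
    exact ⟨(ht h).1, by have := (ht h).2; lia⟩
  · simp only [Spec, run, cost, h, if_false]
    exact ⟨(hs h).1, by have := (hs h).2; lia⟩

theorem loop (I : ℕ → PState → Prop) (hN : e.eval σ = N) (h0 : I 0 σ)
    (hs : ∀ r < N, ∀ τ, s.Frame σ τ → I r τ → s.Spec τ (I (r + 1)) B) :
    (PStmt.loop e s).Spec σ (I N) (e.cost + 2 + N * (B + 4)) := by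
  have hI : ∀ r ≤ N, I r (s.run^[r] σ) := fun r hr => by
    induction r with
    | zero => exact h0
    | succ r ih =>
      rw [Function.iterate_succ_apply']
      exact (hs r hr _ (.iterate s.frame_run r σ) (ih (Nat.le_of_succ_le hr))).1
  refine ⟨by simpa only [run, hN] using hI N le_rfl, ?_⟩
  simp only [cost, hN]
  refine Nat.add_le_add_left ((Finset.sum_le_card_nsmul _ _ (B + 4) fun r hr => ?_).trans
    (by simp)) _
  have hr := Finset.mem_range.1 hr
  exact Nat.add_le_add_right (hs r hr _ (.iterate s.frame_run r σ) (hI r hr.le)).2 4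

end Spec

/-- Statements without loops. -/
def loopFree : PStmt → Bool
  | skip => true
  | set _ _ => true
  | put _ _ _ => true
  | seq s t => s.loopFree && t.loopFree
  | ite _ s t => s.loopFree && t.loopFree
  | loop _ _ => false

/-- A bound for the cost of a statement without loops; `0` is a dummy value at loops. -/
def bound : PStmt → ℕ
  | skip => 0
  | set _ e => e.cost + 1
  | put _ i e => i.cost + e.cost + 7
  | seq s t => s.bound + t.bound
  | ite e s t => e.cost + 2 + (s.bound + t.bound)
  | loop _ _ => 0

theorem cost_le_bound {s : PStmt} (hs : s.loopFree = true) (σ : PState) : s.cost σ ≤ s.bound := by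
  induction s generalizing σ with
  | skip | set _ _ | put _ _ _ => exact le_rfl
  | seq s t ihs iht =>
    rw [loopFree, Bool.and_eq_true] at hs
    exact Nat.add_le_add (ihs hs.1 _) (iht hs.2 _)
  | ite e s t ihs iht =>
    rw [loopFree, Bool.and_eq_true] at hs
    have hcs := ihs hs.1 σ
    have hct := iht hs.2 σ
    rw [cost, bound]
    split <;> lia
  | loop e s => exact absurd hs Bool.false_ne_true

theorem Spec.of_loopFree {s : PStmt} {σ : PState} {Q : PState → Prop} {B : ℕ}
    (hs : s.loopFree = true) (hB : s.bound ≤ B) (hQ : Q (s.run σ)) : s.Spec σ Q B :=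
  ⟨hQ, (cost_le_bound hs σ).trans hB⟩

@[simp] theorem run_skip (σ : PState) : skip.run σ = σ := rfl

@[simp] theorem run_set (x : Var) (e : PExpr) (σ : PState) :
    (set x e).run σ = σ.setVar x (e.eval σ) := rfl

@[simp] theorem run_put (r : Arr) (i e : PExpr) (σ : PState) :
    (put r i e).run σ = σ.setArr r (i.eval σ) (e.eval σ) := rfl

@[simp] theorem run_seq (s t : PStmt) (σ : PState) : (seq s t).run σ = t.run (s.run σ) := rfl

@[simp] theorem run_ite (e : PExpr) (s t : PStmt) (σ : PState) :
    (ite e s t).run σ = if e.eval σ = 0 then t.run σ else s.run σ := rfl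

end PStmt

infixr:60 " ;; " => PStmt.seq

namespace PExpr

instance : Coe Var PExpr := ⟨PExpr.var⟩

instance (k : ℕ) : OfNat PExpr k := ⟨PExpr.const k⟩

instance : Add PExpr := ⟨PExpr.add⟩

instance : Sub PExpr := ⟨PExpr.sub⟩

@[simp] theorem eval_var (σ : PState) (x : Var) : (PExpr.var x).eval σ = σ.var x := rfl

@[simp] theorem eval_ofNat (σ : PState) (k : ℕ) : (ofNat(k) : PExpr).eval σ = OfNat.ofNat k :=
  rfl

@[simp] theorem eval_add (σ : PState) (a b : PExpr) : (a + b).eval σ = a.eval σ + b.eval σ := rfl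

@[simp] theorem eval_sub (σ : PState) (a b : PExpr) : (a - b).eval σ = a.eval σ - b.eval σ := rfl

@[simp] theorem eval_half (σ : PState) (a : PExpr) : a.half.eval σ = a.eval σ / 2 := rfl

@[simp] theorem eval_get (σ : PState) (r : Arr) (a : PExpr) :
    (PExpr.get r a).eval σ = σ.arr r (a.eval σ) := rfl

@[simp] theorem eval_raw (σ : PState) (a : PExpr) : a.raw.eval σ = σ.mem (a.eval σ) := rfl

/-- An expression for the truth value of `a = b`. -/
def eq (a b : PExpr) : PExpr := 1 - ((a - b) + (b - a))

@[simp] theorem eval_eq (σ : PState) (a b : PExpr) :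
    (eq a b).eval σ = if a.eval σ = b.eval σ then 1 else 0 := by
  simp only [eq, eval_sub, eval_add, eval_ofNat]
  split <;> lia

end PExpr

namespace PStmt

/-- `for x = 0, …, e - 1 do s`, where `e` is evaluated once. -/
def forTo (x : Var) (e : PExpr) (s : PStmt) : PStmt :=
  set x 0 ;; loop e (s ;; set x (x + 1))

theorem Spec.forTo {x : Var} {e : PExpr} {s : PStmt} {σ : PState} {N B : ℕ}
    (J : ℕ → PState → Prop) (hx : x ∉ s.vars) (hN : e.eval (σ.setVar x 0) = N)
    (hJ : ∀ r τ c, J r τ → J r (τ.setVar x c)) (h0 : J 0 σ)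
    (hs : ∀ r < N, ∀ τ, (forTo x e s).Frame σ τ → τ.var x = r → J r τ → s.Spec τ (J (r + 1)) B) :
    (forTo x e s).Spec σ (J N) (e.cost + 4 + N * (B + 8)) := by
  have hsub : (s ;; set x (x + 1)).vars ⊆ (PStmt.forTo x e s).vars := List.subset_cons_self _ _
  refine (set_seq ((loop (B := B + 4) (fun r τ => τ.var x = r ∧ J r τ) hN ⟨by simp, hJ _ _ _ h0⟩
    fun r hr τ hF h => ?_).mono (fun _ _ h => h.2) le_rfl)).le (B := 2 + _) ?_
  · refine (hs r hr τ ((Frame.setVar (by simp [PStmt.forTo, vars]) σ 0).trans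
      (hF.mono hsub (List.Subset.refl _))) h.1 h.2).seq fun υ hF' hυ => ?_
    refine .of_loopFree rfl le_rfl ⟨?_, hJ _ _ _ hυ⟩
    simp [hF'.var hx, h.1]
  · lia

/-- `for i = 0, …, rows - 1 do for j = 0, …, cols - 1 do s`, where `idx` counts the executions
of `s`. The value of `idx` at the beginning is arbitrary, so that `idx` is the position of the entry
`(i, j)` when the grid is stored row by row from there on. -/
def forGrid (rows cols : PExpr) (s : PStmt) : PStmt :=
  forTo .i rows (forTo .j cols (s ;; set .idx (Var.idx + 1)))

theorem Spec.forGrid {rows cols : PExpr} {s : PStmt} {σ : PState} {R C base B : ℕ}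
    (J : ℕ → PState → Prop) (hvars : .i ∉ s.vars ∧ .j ∉ s.vars ∧ .idx ∉ s.vars)
    (hR : ∀ τ, (forGrid rows cols s).Frame σ τ → rows.eval τ = R)
    (hC : ∀ τ, (forGrid rows cols s).Frame σ τ → cols.eval τ = C) (hbase : σ.var .idx = base)
    (hJ : ∀ r τ c, J r τ → J r (τ.setVar .i c) ∧ J r (τ.setVar .j c) ∧ J r (τ.setVar .idx c))
    (h0 : J 0 σ)
    (hs : ∀ a < R, ∀ b < C, ∀ τ, (forGrid rows cols s).Frame σ τ → τ.var .i = a → τ.var .j = b →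
      τ.var .idx = base + (a * C + b) → J (a * C + b) τ → s.Spec τ (J (a * C + b + 1)) B) :
    (forGrid rows cols s).Spec σ (J (R * C))
      (rows.cost + 4 + R * (cols.cost + 4 + C * (B + 4 + 8) + 8)) := by
  obtain ⟨hi, hj, hidx⟩ := hvars
  refine (Spec.forTo (x := .i) (fun a τ => τ.var .idx = base + a * C ∧ J (a * C) τ)
    (by simpa [PStmt.forTo, vars] using hi) (hR _ (.setVar (by simp [PStmt.forGrid, PStmt.forTo,
    vars]) σ 0)) (fun _ _ _ h => ⟨h.1, (hJ _ _ _ h.2).1⟩) (by simpa using ⟨hbase, h0⟩)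
    fun a ha τ hF hia h => ?_).mono (fun _ _ h => h.2) le_rfl
  refine (Spec.forTo (x := .j) (fun b τ => τ.var .idx = base + (a * C + b) ∧ J (a * C + b) τ)
    (by simpa [vars] using hj)
    (hC _ (hF.trans (.setVar (by simp [PStmt.forTo, vars]) τ 0)))
    (fun _ _ _ h => ⟨h.1, (hJ _ _ _ h.2).2.1⟩) h fun b hb υ hF' hjb h' => ?_).mono
    (fun _ _ h => by rwa [Nat.succ_mul]) le_rfl
  have hυ : (PStmt.forGrid rows cols s).Frame σ υ := hF.trans (hF'.mono
    (fun _ h => List.mem_append_right _ (List.mem_append_left _ h))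
    (fun _ h => List.mem_append_right _ (List.mem_append_left _ h)))
  refine (hs a ha b hb υ hυ ((hF'.var (by simpa [PStmt.forTo, vars] using hi)).trans hia) hjb h'.1
    h'.2).seq fun ω hω hJω => .of_loopFree rfl le_rfl ⟨?_, (hJ _ _ _ hJω).2.2⟩
  simp [hω.var hidx, h'.1, add_assoc]

end PStmt

open PStmt PExpr

/-! ## The pointer phase -/

/-- The entry of the order table for the elements `a` and `b`. -/
def PState.table (σ : PState) (a b : ℕ) : ℕ := σ.arr .inp (σ.arr .row a + b)

theorem PStmt.Frame.table {s : PStmt} {σ τ : PState} (h : s.Frame σ τ) (hi : .inp ∉ s.arrs)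
    (hr : .row ∉ s.arrs) : τ.table = σ.table := by
  funext a b
  rw [PState.table, PState.table, h.arr hi, h.arr hr]

/-- Check the constraint between the pointers `i` and `j`. -/
def checkPair : PStmt :=
  set .val (get .con Var.idx + get .inp (get .row (get .ptr Var.i) + get .ptr Var.j)) ;;
  ite (.eq Var.val 1)
    (set .found 1 ;;
      ite (get .con Var.idx) (set .fi Var.j ;; set .fj Var.i) (set .fi Var.i ;; set .fj Var.j))
    skip

/-- Look for a violated constraint between the pointers `0, …, m - 1`. -/
def findViolation : PStmt :=
  set .found 0 ;; set .idx 0 ;; forGrid Var.m Var.m checkPair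

/-- Move pointer number `fi` to the next element of its chain, or fail if there is none. -/
def advance : PStmt :=
  set .elt (get .ptr Var.fi) ;;
  put .wit Var.elt (get .ptr Var.fj) ;;
  ite (get .nxt Var.elt) (put .ptr Var.fi (get .nxt Var.elt - 1)) (set .fail 1 ;; set .last Var.elt)

/-- One round of the pointer phase. -/
def phaseStep : PStmt := findViolation ;; ite Var.found (ite Var.fail skip advance) skip

/-- Advance pointers until all constraints hold or a chain is exhausted. -/
def phase : PStmt :=
  set .acc 1 ;; forTo .i Var.m (set .acc (Var.acc + Var.n)) ;; set .fail 0 ;; loop Var.acc phaseStep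

/-- The constraint that the state `τ` points to is violated in the state `σ`. -/
def FindsViolation (m : ℕ) (σ τ : PState) : Prop :=
  τ.var .fi < m ∧ τ.var .fj < m ∧
    Violated (σ.arr .con) m σ.table (σ.arr .ptr) (τ.var .fi) (τ.var .fj)

theorem checkPair_spec_of_eq_one {σ τ : PState} {m a b : ℕ} (hi : τ.var .i = a) (hj : τ.var .j = b)
    (hidx : τ.var .idx = a * m + b) (ha : a < m) (hb : b < m) (hcon : τ.arr .con = σ.arr .con)
    (hptr : τ.arr .ptr = σ.arr .ptr) (htab : τ.table = σ.table)
    (h : σ.arr .con (a * m + b) + σ.table (σ.arr .ptr a) (σ.arr .ptr b) = 1) :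
    checkPair.Spec τ (fun υ => υ.var .found ≠ 0 ∧ FindsViolation m σ υ) 80 := by
  have hentry : τ.arr .inp (τ.arr .row (σ.arr .ptr a) + σ.arr .ptr b) =
    σ.table (σ.arr .ptr a) (σ.arr .ptr b) := congrFun₂ htab _ _
  refine .of_loopFree rfl (by decide) ?_
  obtain ⟨hc, ht⟩ | ⟨hc, ht⟩ := Nat.add_eq_one_iff.1 h
  · have hV : Violated (σ.arr .con) m σ.table (σ.arr .ptr) a b := .inl ⟨hc, ht⟩
    simp [checkPair, hi, hj, hidx, hcon, hptr, hentry, hc, ht, FindsViolation, ha, hb, hV]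
  · have hV : Violated (σ.arr .con) m σ.table (σ.arr .ptr) b a := .inr ⟨hc, ht⟩
    simp [checkPair, hi, hj, hidx, hcon, hptr, hentry, hc, ht, FindsViolation, ha, hb, hV]

theorem checkPair_spec_of_ne_one {τ : PState}
    (h : τ.arr .con (τ.var .idx) +
      τ.table (τ.arr .ptr (τ.var .i)) (τ.arr .ptr (τ.var .j)) ≠ 1) :
    checkPair.Spec τ (fun υ => υ.var .found = τ.var .found ∧ υ.var .fi = τ.var .fi ∧
      υ.var .fj = τ.var .fj) 80 := by
  rw [PState.table] at h
  exact .of_loopFree rfl (by decide) (by simp [checkPair, h])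

theorem findViolation_spec {σ : PState} {m : ℕ} (hm : σ.var .m = m) :
    findViolation.Spec σ (fun τ =>
      (τ.var .found = 0 ∧ AllHold (σ.arr .con) m σ.table (σ.arr .ptr)) ∨
      (τ.var .found ≠ 0 ∧ FindsViolation m σ τ)) (200 * (m + 1) ^ 2) := by
  refine .le (.set_seq <| .set_seq <| .mono (Spec.forGrid (R := m) (C := m) (base := 0) (B := 80)
    (fun r τ => (τ.var .found = 0 ∧ ∀ a < m, ∀ b < m, a * m + b < r →
        σ.arr .con (a * m + b) + σ.table (σ.arr .ptr a) (σ.arr .ptr b) ≠ 1) ∨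
      (τ.var .found ≠ 0 ∧ FindsViolation m σ τ))
    (by decide) (fun τ hF => (hF.var (x := .m) (by decide)).trans hm)
    (fun τ hF => (hF.var (x := .m) (by decide)).trans hm) rfl (fun _ _ _ h => ⟨h, h, h⟩)
    (Or.inl ⟨rfl, fun _ _ _ _ h => absurd h (Nat.not_lt_zero _)⟩)
    fun a ha b hb τ hF hi hj hidx hI => ?_) ?_ le_rfl) ?_
  · rw [zero_add] at hidx
    have hcon : τ.arr .con = σ.arr .con := hF.arr (by decide)
    have hptr : τ.arr .ptr = σ.arr .ptr := hF.arr (by decide)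
    have htab : τ.table = σ.table := hF.table (by decide) (by decide)
    by_cases h : σ.arr .con (a * m + b) + σ.table (σ.arr .ptr a) (σ.arr .ptr b) = 1
    · exact (checkPair_spec_of_eq_one hi hj hidx ha hb hcon hptr htab h).mono
        (fun _ _ => Or.inr) le_rfl
    · refine (checkPair_spec_of_ne_one (by rwa [hi, hj, hidx, hcon, hptr, htab])).mono
        (fun υ _ hυ => ?_) le_rfl
      simp only [FindsViolation, hυ.1, hυ.2.1, hυ.2.2]
      refine hI.imp_left fun hI => ⟨hI.1, fun a' ha' b' hb' hlt => ?_⟩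
      rcases Nat.lt_succ_iff_lt_or_eq.1 hlt with hlt | heq
      · exact hI.2 a' ha' b' hb' hlt
      · obtain ⟨rfl, rfl⟩ := mul_add_inj hb' hb heq
        exact h
  · exact fun τ _ h => h.imp_left fun h => ⟨h.1, fun a ha b hb =>
      h.2 a ha b hb (mul_add_lt_mul ha hb)⟩
  · simp only [PExpr.cost]
    lia

/-- How a round of the pointer phase may lead from the state `σ` to the state `τ`. -/
inductive PhaseStep (m : ℕ) (σ τ : PState) : Prop
  | idle : σ.var .fail ≠ 0 ∨ AllHold (σ.arr .con) m σ.table (σ.arr .ptr) →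
    τ.var .fail = σ.var .fail → τ.var .last = σ.var .last → τ.arr .ptr = σ.arr .ptr →
    τ.arr .wit = σ.arr .wit → PhaseStep m σ τ
  | advance {a b x : ℕ} : σ.var .fail = 0 → a < m → b < m →
    Violated (σ.arr .con) m σ.table (σ.arr .ptr) a b → σ.arr .nxt (σ.arr .ptr a) = x + 1 →
    τ.var .fail = 0 → τ.arr .ptr = Function.update (σ.arr .ptr) a x →
    τ.arr .wit = Function.update (σ.arr .wit) (σ.arr .ptr a) (σ.arr .ptr b) → PhaseStep m σ τ
  | stuck {a b : ℕ} : σ.var .fail = 0 → a < m → b < m →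
    Violated (σ.arr .con) m σ.table (σ.arr .ptr) a b → σ.arr .nxt (σ.arr .ptr a) = 0 →
    τ.var .fail ≠ 0 → τ.var .last = σ.arr .ptr a →
    τ.arr .wit = Function.update (σ.arr .wit) (σ.arr .ptr a) (σ.arr .ptr b) → PhaseStep m σ τ

theorem phaseStep_spec {σ : PState} {m : ℕ} (hm : σ.var .m = m) :
    phaseStep.Spec σ (PhaseStep m σ) (300 * (m + 1) ^ 2) := by
  refine ((findViolation_spec hm).seq (B' := 80) fun τ hF hτ =>
    .of_loopFree rfl (by decide) ?_).le (by nlinarith)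
  have hfail : τ.var .fail = σ.var .fail := hF.var (by decide)
  have hlast : τ.var .last = σ.var .last := hF.var (by decide)
  have hptr : τ.arr .ptr = σ.arr .ptr := hF.arr (by decide)
  have hwit : τ.arr .wit = σ.arr .wit := hF.arr (by decide)
  have hnxt : τ.arr .nxt = σ.arr .nxt := hF.arr (by decide)
  rcases hτ with ⟨hfound, hA⟩ | ⟨hfound, hfi, hfj, hV⟩
  · simp only [run_ite, eval_var, hfound, if_true, run_skip]
    exact .idle (.inr hA) hfail hlast hptr hwit
  by_cases hf : σ.var .fail = 0
  · rcases hx : σ.arr .nxt (σ.arr .ptr (τ.var .fi)) with _ | x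
    · exact .stuck hf hfi hfj hV hx (by simp [advance, hfound, hfail, hf, hnxt, hptr, hx])
        (by simp [advance, hfound, hfail, hf, hnxt, hptr, hx])
        (by simp [advance, hfound, hfail, hf, hnxt, hptr, hwit, hx])
    · exact .advance hf hfi hfj hV hx (by simp [advance, hfound, hfail, hf, hnxt, hptr, hx])
        (by simp [advance, hfound, hfail, hf, hnxt, hptr, hx])
        (by simp [advance, hfound, hfail, hf, hnxt, hptr, hwit, hx])
  · simp only [run_ite, eval_var, hfound, hfail, hf, if_false, run_skip]
    exact .idle (.inl hf) hfail hlast hptr hwit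

/-- Advances of pointers with the data of the state `σ`. -/
abbrev PState.Run (σ : PState) (m t : ℕ) (ptr wit : ℕ → ℕ) : Prop :=
  PointerRun (σ.arr .con) m σ.table (σ.arr .nxt) (σ.arr .ptr) (σ.arr .wit) t ptr wit

/-- How the pointer phase may lead from the state `σ` to the state `τ`. -/
inductive PhaseOutcome (m : ℕ) (σ τ : PState) : Prop
  | solved {t : ℕ} {wit : ℕ → ℕ} : τ.var .fail = 0 → σ.Run m t (τ.arr .ptr) wit →
    AllHold (σ.arr .con) m σ.table (τ.arr .ptr) → PhaseOutcome m σ τ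
  | stuck {t a b : ℕ} {ptr wit : ℕ → ℕ} : τ.var .fail ≠ 0 → σ.Run m t ptr wit → a < m → b < m →
    Violated (σ.arr .con) m σ.table ptr a b → σ.arr .nxt (ptr a) = 0 → τ.var .last = ptr a →
    τ.arr .wit = Function.update wit (ptr a) (ptr b) → PhaseOutcome m σ τ

theorem Violated.not_allHold {con ptr : ℕ → ℕ} {m a b : ℕ} {tab : ℕ → ℕ → ℕ}
    (h : Violated con m tab ptr a b) (ha : a < m) (hb : b < m) : ¬AllHold con m tab ptr :=
  fun hA => h.elim (fun h => hA a ha b hb (by lia)) fun h => hA b hb a ha (by lia)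

theorem PhaseOutcome.step {m r : ℕ} {σ τ υ : PState} (hcon : τ.arr .con = σ.arr .con)
    (hnxt : τ.arr .nxt = σ.arr .nxt) (htab : τ.table = σ.table)
    (h : (τ.var .fail = 0 ∧ σ.Run m r (τ.arr .ptr) (τ.arr .wit)) ∨ PhaseOutcome m σ τ)
    (hstep : PhaseStep m τ υ) :
    (υ.var .fail = 0 ∧ σ.Run m (r + 1) (υ.arr .ptr) (υ.arr .wit)) ∨ PhaseOutcome m σ υ := by
  cases hstep with
  | idle hidle hfail hlast hptr hwit =>
    rw [hcon, htab] at hidle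
    refine .inr ?_
    obtain ⟨hf, hrun⟩ | ⟨hf, hrun, hA⟩ | ⟨hf, hrun, ha, hb, hV, hx, hl, hw⟩ := h
    · exact .solved (hfail.trans hf) (hptr ▸ hrun) (hptr ▸ hidle.resolve_left (not_not.2 hf))
    · exact .solved (hfail.trans hf) (hptr ▸ hrun) (hptr ▸ hA)
    · exact .stuck (hfail ▸ hf) hrun ha hb hV hx (hlast.trans hl) (hwit.trans hw)
  | advance hf ha hb hV hx hfail hptr hwit =>
    rw [hcon, htab] at hV
    rw [hnxt] at hx
    obtain ⟨-, hrun⟩ | ⟨-, -, hA⟩ | ⟨hf', -⟩ := h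
    · exact .inl ⟨hfail, hptr ▸ hwit ▸ hrun.advance ha hb hV hx⟩
    · exact absurd hA (hV.not_allHold ha hb)
    · exact absurd hf hf'
  | stuck hf ha hb hV hx hfail hlast hwit =>
    rw [hcon, htab] at hV
    rw [hnxt] at hx
    obtain ⟨-, hrun⟩ | ⟨-, -, hA⟩ | ⟨hf', -⟩ := h
    · exact .inr (.stuck hfail hrun ha hb hV hx hlast hwit)
    · exact absurd hA (hV.not_allHold ha hb)
    · exact absurd hf hf'

theorem phase_spec {σ : PState} {m n : ℕ} (hm : σ.var .m = m) (hn : σ.var .n = n)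
    (hle : ∀ {t ptr wit}, σ.Run m t ptr wit → t ≤ m * n) :
    phase.Spec σ (fun τ => τ.var .acc = m * n + 1 ∧ PhaseOutcome m σ τ)
      (500 * (m + 1) ^ 3 * (n + 1)) := by
  refine .le (.set_seq <| .seq (Spec.forTo (x := .i) (B := 4) (N := m)
    (fun r τ => τ.var .acc = r * n + 1) (by decide) hm (fun _ _ _ h => h) (by simp)
    fun r _ τ hF _ hacc => .of_loopFree rfl (by decide) ?_) fun τ hF hacc => .set_seq <|
    .mono (Spec.loop (N := m * n + 1) (B := 300 * (m + 1) ^ 2) (fun r τ =>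
      (τ.var .fail = 0 ∧ σ.Run m r (τ.arr .ptr) (τ.arr .wit)) ∨ PhaseOutcome m σ τ) hacc
      (.inl ⟨rfl, ?_⟩) fun r _ υ hF' hI => (phaseStep_spec (m := m)
        ((hF'.var (by decide)).trans ((hF.var (by decide)).trans hm))).mono
        (fun ω _ hω => PhaseOutcome.step ?_ ?_ ?_ hI hω) le_rfl)
      (fun υ hF' hυ => ⟨?_, ?_⟩) le_rfl) ?_
  · have : τ.var .n = n := (hF.var (by decide)).trans hn
    simp only [run_set, PState.setVar_var, if_true, eval_add, eval_var, hacc, this]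
    ring
  · have hptr : τ.arr .ptr = σ.arr .ptr := hF.arr (by decide)
    have hwit : τ.arr .wit = σ.arr .wit := hF.arr (by decide)
    exact hptr ▸ hwit ▸ PointerRun.start
  · exact (hF'.arr (by decide)).trans (hF.arr (by decide))
  · exact (hF'.arr (by decide)).trans (hF.arr (by decide))
  · exact (hF'.table (by decide) (by decide)).trans (hF.table (by decide) (by decide))
  · exact (hF'.var (by decide)).trans hacc
  · exact hυ.resolve_left fun h => absurd (hle h.2) (by lia)
  · simp only [PExpr.cost]
    have h3 : m * n ≤ (m + 1) ^ 2 * (m * n) := Nat.le_mul_of_pos_left _ (by positivity)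
    have h4 : m + 1 ≤ (m + 1) ^ 3 := Nat.le_self_pow (by lia) _
    nlinarith [Nat.zero_le ((m + 1) ^ 2 * n)]

/-! ## Computing a chain cover -/

/-- Compute `nxt`, `head` and `m` from `prv`, and let the pointers start at the heads. -/
def scanChains : PStmt :=
  forTo .i Var.v (put .nxt Var.i 0) ;; set .m 0 ;;
  forTo .i Var.v (ite (get .prv Var.i) (put .nxt (get .prv Var.i - 1) (Var.i + 1))
    (put .head Var.m Var.i ;; put .ptr Var.m Var.i ;; set .m (Var.m + 1)))

/-- Demand that the pointers form an antichain. -/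
def demandAntichain : PStmt :=
  set .idx 0 ;; forGrid Var.m Var.m (put .con Var.idx
    (PExpr.eq Var.i Var.j + PExpr.eq Var.i Var.j))

/-- Follow the augmenting trail that starts at `last`. -/
def exchange : PStmt :=
  set .finish 0 ;; set .cur Var.last ;;
  loop Var.acc (ite Var.finish skip
    (set .tgt (get .wit Var.cur) ;; set .elt (get .prv Var.tgt) ;; put .prv Var.tgt (Var.cur + 1) ;;
      ite Var.elt (set .cur (Var.elt - 1)) (set .finish 1)))

/-- Look for an antichain with an element in each chain. If there is none, then the failed search
yields a cover with one chain less. -/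
def searchAntichain : PStmt := phase ;; ite Var.fail exchange skip

/-- Decrease the number of chains by one if it exceeds the width. -/
def reduceCover : PStmt := scanChains ;; demandAntichain ;; searchAntichain

/-- Extend the chain cover of `{0, …, v - 1}` to the element `v`, at first as a chain of its own. -/
def insertElement : PStmt :=
  put .prv Var.v 0 ;; set .v (Var.v + 1) ;; reduceCover

/-- Compute a cover of the poset by as few chains as its width allows. -/
def coverByChains : PStmt := set .v 0 ;; loop Var.n insertElement ;; scanChains

/-- `IsChainData` after `r` elements have been scanned. -/
structure IsPartialChainData (prv nxt head : ℕ → ℕ) (v r m : ℕ) : Prop where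
  prv_of_nxt : ∀ x < v, ∀ y, nxt x = y + 1 → y < r ∧ prv y = x + 1
  nxt_of_prv : ∀ y < r, ∀ x, prv y = x + 1 → nxt x = y + 1
  bijOn_head : Set.BijOn head (Set.Iio m) {y | y < r ∧ prv y = 0}

section PartialChainData

variable {tab : ℕ → ℕ → ℕ} {prv nxt head : ℕ → ℕ} {v r m x : ℕ}

theorem isPartialChainData_zero (h : ∀ x < v, nxt x = 0) :
    IsPartialChainData prv nxt head v 0 0 where
  prv_of_nxt x hx y hy := by rw [h x hx] at hy; lia
  nxt_of_prv _ hy := absurd hy (Nat.not_lt_zero _)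
  bijOn_head := by simp [Set.BijOn, Set.MapsTo, Set.SurjOn, Set.InjOn]

theorem IsPartialChainData.update_nxt (h : IsPartialChainData prv nxt head v r m)
    (hM : IsMatching tab prv v) (hr : r < v) (hx : prv r = x + 1) :
    IsPartialChainData prv (Function.update nxt x (r + 1)) head v (r + 1) m where
  prv_of_nxt z hz y hy := by
    rcases eq_or_ne z x with rfl | hzx
    · obtain rfl : r = y := by simpa using hy
      exact ⟨Nat.lt_succ_self r, hx⟩
    · exact (h.prv_of_nxt z hz y (by simpa [hzx] using hy)).imp_left Nat.lt_succ_of_lt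
  nxt_of_prv y hy z hz := by
    rcases Nat.lt_succ_iff_lt_or_eq.1 hy with hy | rfl
    · have hzx : z ≠ x := by
        rintro rfl
        exact hy.ne (hM.inj y (hy.trans hr) r hr z hz hx)
      simpa [hzx] using h.nxt_of_prv y hy z hz
    · obtain rfl : x = z := by lia
      simp
  bijOn_head := by
    convert h.bijOn_head using 3 with y
    rw [Nat.lt_succ_iff_lt_or_eq]
    refine ⟨fun ⟨hy, h0⟩ => ⟨hy.resolve_right ?_, h0⟩, fun ⟨hy, h0⟩ => ⟨.inl hy, h0⟩⟩
    rintro rfl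
    lia

theorem IsPartialChainData.update_head (h : IsPartialChainData prv nxt head v r m)
    (hx : prv r = 0) :
    IsPartialChainData prv nxt (Function.update head m r) v (r + 1) (m + 1) where
  prv_of_nxt x hx y hy := (h.prv_of_nxt x hx y hy).imp_left Nat.lt_succ_of_lt
  nxt_of_prv y hy x hyx := by
    rcases Nat.lt_succ_iff_lt_or_eq.1 hy with hy | rfl
    · exact h.nxt_of_prv y hy x hyx
    · lia
  bijOn_head := by
    have hold : Set.BijOn (Function.update head m r) (Set.Iio m) {y | y < r ∧ prv y = 0} :=
      h.bijOn_head.congr fun i hi => by simp [(Set.mem_Iio.1 hi).ne]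
    convert hold.insert (a := m) (by simp) using 1
    · ext i
      simp
    · ext y
      simp only [Function.update_self, Set.mem_insert_iff, Set.mem_ofPred_eq,
        Nat.lt_succ_iff_lt_or_eq]
      constructor
      · rintro ⟨hy | rfl, h0⟩
        exacts [.inr ⟨hy, h0⟩, .inl rfl]
      · rintro (rfl | ⟨hy, h0⟩)
        exacts [⟨.inr rfl, hx⟩, ⟨.inl hy, h0⟩]

end PartialChainData

theorem scanChains_spec {σ : PState} {tab : ℕ → ℕ → ℕ} {v : ℕ} (hv : σ.var .v = v)
    (hM : IsMatching tab (σ.arr .prv) v) :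
    scanChains.Spec σ (fun τ => IsChainData (σ.arr .prv) (τ.arr .nxt) (τ.arr .head) v (τ.var .m) ∧
      ∀ i < τ.var .m, τ.arr .ptr i = τ.arr .head i) (200 * (v + 1)) := by
  refine .le (.seq (Spec.forTo (x := .i) (B := 20) (N := v) (fun r τ => ∀ x < r, τ.arr .nxt x = 0)
    (by decide) hv (fun _ _ _ h => h) (fun _ h => absurd h (Nat.not_lt_zero _))
    fun r _ τ _ hi hI => .of_loopFree rfl (by decide) fun x hx => ?_)
    fun τ hF hτ => .set_seq <| .mono (Spec.forTo (x := .i) (B := 60) (N := v) (fun r υ =>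
      IsPartialChainData (σ.arr .prv) (υ.arr .nxt) (υ.arr .head) v r (υ.var .m) ∧
      ∀ i < υ.var .m, υ.arr .ptr i = υ.arr .head i) (by decide) ((hF.var (by decide)).trans hv)
      (fun _ _ _ h => h) ⟨isPartialChainData_zero hτ, fun _ h => absurd h (Nat.not_lt_zero _)⟩
      fun r hr υ hF' hi hI => .of_loopFree rfl (by decide) ?_)
      (fun υ _ hυ => ⟨⟨hυ.1.prv_of_nxt, hυ.1.nxt_of_prv, hυ.1.bijOn_head⟩, hυ.2⟩) le_rfl) ?_
  · rcases Nat.lt_succ_iff_lt_or_eq.1 hx with hx | rfl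
    · simp [hi, hx.ne, hI x hx]
    · simp [hi]
  · have hprv : υ.arr .prv = σ.arr .prv := (hF'.arr (by decide)).trans (hF.arr (by decide))
    rcases hx : σ.arr .prv r with _ | x
    · refine ⟨by simpa [hprv, hi, hx] using hI.1.update_head hx, fun i hlt => ?_⟩
      have hlt : i < υ.var .m + 1 := by simpa [hprv, hi, hx] using hlt
      rcases Nat.lt_succ_iff_lt_or_eq.1 hlt with hlt | rfl
      · simp [hprv, hi, hx, hlt.ne, hI.2 i hlt]
      · simp [hprv, hi, hx]
    · exact ⟨by simpa [hprv, hi, hx] using hI.1.update_nxt hM hr hx,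
        by simpa [hprv, hi, hx] using hI.2⟩
  · simp only [PExpr.cost]
    lia

theorem demandAntichain_spec {σ : PState} {m : ℕ} (hm : σ.var .m = m) :
    demandAntichain.Spec σ (fun τ => DemandsAntichain (τ.arr .con) m) (100 * (m + 1) ^ 2) := by
  refine .le (.set_seq <| .mono (Spec.forGrid (R := m) (C := m) (base := 0) (B := 60)
    (fun r τ => ∀ a < m, ∀ b < m, a * m + b < r → τ.arr .con (a * m + b) = if a = b then 2 else 0)
    (by decide) (fun τ hF => (hF.var (x := .m) (by decide)).trans hm)
    (fun τ hF => (hF.var (x := .m) (by decide)).trans hm) rfl (fun _ _ _ h => ⟨h, h, h⟩)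
    (fun _ _ _ _ h => absurd h (Nat.not_lt_zero _))
    fun a ha b hb τ _ hi hj hidx hI => .of_loopFree rfl (by decide) fun a' ha' b' hb' hlt => ?_)
    (fun τ _ h a ha b hb => h a ha b hb (mul_add_lt_mul ha hb)) le_rfl) ?_
  · rw [zero_add] at hidx
    rcases Nat.lt_succ_iff_lt_or_eq.1 hlt with hlt | heq
    · simp [hidx, hlt.ne, hI a' ha' b' hb' hlt]
    · obtain ⟨rfl, rfl⟩ := mul_add_inj hb' hb heq
      simp only [run_put, PState.setArr_arr, if_true, eval_var, hidx, Function.update_self,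
        eval_add, eval_eq, hi, hj]
      split <;> rfl
  · simp only [PExpr.cost]
    nlinarith

theorem exchange_spec {σ : PState} {tab : ℕ → ℕ → ℕ} {rank : ℕ → ℕ} {v N : ℕ}
    (hN : σ.var .acc = N) (hrank : rank (σ.var .last) ≤ N)
    (hT : AugmentingTrail tab (σ.arr .prv) (σ.arr .wit) rank v (σ.var .last)) :
    exchange.Spec σ (fun τ => IsMatching tab (τ.arr .prv) v ∧
      chainCount (τ.arr .prv) v + 1 = chainCount (σ.arr .prv) v) (100 * (N + 1)) := by
  refine .le (.set_seq <| .set_seq <| .mono (Spec.loop (N := N) (B := 70) (fun r τ =>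
    (τ.var .finish = 0 ∧ AugmentingTrail tab (τ.arr .prv) (σ.arr .wit) rank v (τ.var .cur) ∧
      rank (τ.var .cur) + r ≤ N ∧ chainCount (τ.arr .prv) v = chainCount (σ.arr .prv) v) ∨
    (τ.var .finish ≠ 0 ∧ IsMatching tab (τ.arr .prv) v ∧
      chainCount (τ.arr .prv) v + 1 = chainCount (σ.arr .prv) v)) hN
    (.inl ⟨rfl, hT, hrank, rfl⟩) fun r _ τ hF hI => .of_loopFree rfl (by decide) ?_)
    (fun τ _ hτ => ?_) le_rfl) ?_
  · have hwit : τ.arr .wit = σ.arr .wit := hF.arr (by decide)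
    rcases hI with ⟨hf, hT, hle, hcount⟩ | ⟨hf, hI⟩
    · have hcur := hT.trail _ hT.lt hT.rank_pos le_rfl
      rcases hz : τ.arr .prv (σ.arr .wit (τ.var .cur)) with _ | z
      · refine .inr ⟨by simp [hf, hwit, hz], by simpa [hf, hwit, hz] using hT.isMatching_update, ?_⟩
        rw [← hcount, ← chainCount_update_of_eq_zero (x := τ.var .cur) hcur.lt hz]
        simp [hf, hwit, hz]
      · obtain ⟨hlt, hT'⟩ := hT.descend hz
        refine .inl ⟨by simp [hf, hwit, hz], by simpa [hf, hwit, hz] using hT', ?_, ?_⟩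
        · suffices rank z + (r + 1) ≤ N by simpa [hf, hwit, hz] using this
          lia
        · rw [← hcount,
            ← chainCount_update_of_ne_zero (x := τ.var .cur) (hz.trans_ne z.succ_ne_zero)]
          simp [hf, hwit, hz]
    · exact .inr (by simpa [hf] using hI)
  · exact (hτ.resolve_left fun h => absurd h.2.1.rank_pos (by lia)).2
  · simp only [PExpr.cost]
    lia

theorem searchAntichain_spec {σ : PState} {v n m w : ℕ} (hm : σ.var .m = m) (hn : σ.var .n = n)
    (hO : IsOrderTable σ.table v) (hW : WidthLE σ.table v w) (hvn : v ≤ n)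
    (hM : IsMatching σ.table (σ.arr .prv) v)
    (hC : IsChainData (σ.arr .prv) (σ.arr .nxt) (σ.arr .head) v m)
    (hptr : ∀ i < m, σ.arr .ptr i = σ.arr .head i) (hcon : DemandsAntichain (σ.arr .con) m)
    (hmw : m ≤ w + 1) :
    searchAntichain.Spec σ (fun τ => IsMatching σ.table (τ.arr .prv) v ∧
      chainCount (τ.arr .prv) v ≤ w) (800 * (w + 2) ^ 3 * (n + 1)) := by
  have hN : Ascends σ.table (σ.arr .nxt) v := hC.ascends hM
  have hlt : ∀ i < m, σ.arr .ptr i < v := fun i hi => hptr i hi ▸ hC.head_lt hi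
  refine .le (.seq (phase_spec hm hn fun h => (h.length_le hO hN hlt).trans
    (Nat.mul_le_mul_left m hvn)) fun τ hF hτ => .ite (B := 100 * (m * n + 1 + 1)) (fun hf => ?_)
    fun hf => .of_loopFree rfl (Nat.zero_le _) ?_) ?_
  · obtain ⟨hacc, ⟨hf', -⟩ | ⟨-, hR, ha, hb, hV, hx, hlast, hwit⟩⟩ := hτ
    · exact absurd hf' hf
    have hprv : τ.arr .prv = σ.arr .prv := hF.arr (by decide)
    obtain ⟨rank, hS⟩ := hR.antichainSearch hM hC hcon hptr
    obtain ⟨hab, hle⟩ := hV.ne_and_le hcon ha hb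
    have hT := hS.augmentingTrail hM hC ha hb hab hle hx
    rw [← hwit, ← hlast, ← hprv] at hT
    refine (exchange_spec hacc ?_ hT).mono
      (fun υ _ hυ => ⟨hυ.1, ?_⟩) le_rfl
    · have ht := (hR.length_le hO hN hlt).trans (Nat.mul_le_mul_left m hvn)
      simpa [hlast] using ht
    · have hcount := hυ.2
      rw [hprv, ← hC.eq_chainCount] at hcount
      lia
  · obtain ⟨-, ⟨-, hR, hA⟩ | ⟨hf', -⟩⟩ := hτ
    · rw [run_skip, show τ.arr .prv = σ.arr .prv from hF.arr (by decide), ← hC.eq_chainCount]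
      exact ⟨hM, hW.le_of_allHold hcon (hR.ptr_lt hO hN hlt) hA⟩
    · exact absurd hf hf'
  · have h1 : (m + 1) * (n + 1) ≤ (m + 1) ^ 3 * (n + 1) :=
      Nat.mul_le_mul_right _ (Nat.le_self_pow (by lia) _)
    have h2 : (m + 1) ^ 3 * (n + 1) ≤ (w + 2) ^ 3 * (n + 1) :=
      Nat.mul_le_mul_right _ (Nat.pow_le_pow_left (by lia) 3)
    simp only [PExpr.cost]
    nlinarith

theorem reduceCover_spec {σ : PState} {v n w : ℕ} (hv : σ.var .v = v) (hn : σ.var .n = n)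
    (hO : IsOrderTable σ.table v) (hW : WidthLE σ.table v w) (hvn : v ≤ n)
    (hM : IsMatching σ.table (σ.arr .prv) v) (hc : chainCount (σ.arr .prv) v ≤ w + 1) :
    reduceCover.Spec σ (fun τ => IsMatching σ.table (τ.arr .prv) v ∧ chainCount (τ.arr .prv) v ≤ w)
      (1100 * (w + 2) ^ 3 * (n + 1)) := by
  refine .le (.seq (scanChains_spec hv hM) fun τ hF ⟨hC, hptr⟩ => ?_)
    (B := 200 * (v + 1) + (100 * (w + 2) ^ 2 + 800 * (w + 2) ^ 3 * (n + 1))) ?_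
  · have hmw : τ.var .m ≤ w + 1 := hC.eq_chainCount.trans_le hc
    have hm2 : 100 * (τ.var .m + 1) ^ 2 ≤ 100 * (w + 2) ^ 2 := by
      gcongr 100 * ?_ ^ 2
      exact Nat.succ_le_succ hmw
    refine .seq ((demandAntichain_spec rfl).le hm2) fun υ hF' hcon => ?_
    have hprv : υ.arr .prv = σ.arr .prv := (hF'.arr (by decide)).trans (hF.arr (by decide))
    have htab : υ.table = σ.table :=
      (hF'.table (by decide) (by decide)).trans (hF.table (by decide) (by decide))
    have hn' : υ.var .n = n := ((hF'.var (by decide)).trans (hF.var (by decide))).trans hn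
    have hnxt : υ.arr .nxt = τ.arr .nxt := hF'.arr (by decide)
    have hhead : υ.arr .head = τ.arr .head := hF'.arr (by decide)
    have hptr' : υ.arr .ptr = τ.arr .ptr := hF'.arr (by decide)
    rw [← htab] at hO hW hM ⊢
    rw [← hprv] at hM
    rw [← hprv, ← hnxt, ← hhead] at hC
    rw [← hptr', ← hhead] at hptr
    exact searchAntichain_spec (hF'.var (by decide)) hn' hO hW hvn hM hC hptr hcon hmw
  · lia

theorem insertElement_spec {σ : PState} {v n w : ℕ} (hv : σ.var .v = v) (hn : σ.var .n = n)
    (hO : IsOrderTable σ.table n) (hW : WidthLE σ.table n w) (hvn : v < n)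
    (hM : IsMatching σ.table (σ.arr .prv) v) (hc : chainCount (σ.arr .prv) v ≤ w) :
    insertElement.Spec σ (fun τ => τ.var .v = v + 1 ∧ IsMatching σ.table (τ.arr .prv) (v + 1) ∧
      chainCount (τ.arr .prv) (v + 1) ≤ w) (1200 * (w + 2) ^ 3 * (n + 1)) := by
  set σ₁ := (σ.setArr .prv v 0).setVar .v (v + 1) with hσ₁
  have hprv : σ₁.arr .prv = Function.update (σ.arr .prv) v 0 := by simp [hσ₁]
  have htab : σ₁.table = σ.table := by
    funext a b
    simp [PState.table, hσ₁]
  have h : reduceCover.Spec σ₁ (fun τ => IsMatching σ₁.table (τ.arr .prv) (v + 1) ∧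
      chainCount (τ.arr .prv) (v + 1) ≤ w) (1100 * (w + 2) ^ 3 * (n + 1)) :=
    reduceCover_spec (by simp [hσ₁]) (by simp [hσ₁, hn]) (htab ▸ hO.mono hvn) (htab ▸ hW.mono hvn)
      hvn (htab ▸ hprv ▸ hM.extend) (hprv ▸ (chainCount_extend _ v).trans_le (by lia))
  refine .le (.put_seq <| .set_seq (B := 1100 * (w + 2) ^ 3 * (n + 1)) ?_) ?_
  · simp only [eval_var, eval_add, eval_ofNat, PState.setArr_var, hv]
    exact h.mono (fun τ hF hτ => ⟨(hF.var (by decide)).trans (by simp [hσ₁]), htab ▸ hτ⟩) le_rfl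
  · simp only [PExpr.cost]
    lia

theorem coverByChains_spec {σ : PState} {n w : ℕ} (hn : σ.var .n = n)
    (hO : IsOrderTable σ.table n) (hW : WidthLE σ.table n w) :
    coverByChains.Spec σ (fun τ => τ.var .m ≤ w ∧ IsMatching σ.table (τ.arr .prv) n ∧
      IsChainData (τ.arr .prv) (τ.arr .nxt) (τ.arr .head) n (τ.var .m))
      (1500 * (w + 2) ^ 3 * (n + 1) ^ 2) := by
  refine .le (.set_seq <| .seq (Spec.loop (N := n) (B := 1200 * (w + 2) ^ 3 * (n + 1))
    (fun r τ => τ.var .v = r ∧ IsMatching σ.table (τ.arr .prv) r ∧ chainCount (τ.arr .prv) r ≤ w)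
    hn ⟨rfl, isMatching_zero _ _, Nat.zero_le _⟩ fun r hr τ hF ⟨hv, hM, hc⟩ => ?_)
    fun τ _ ⟨hv, hM, hc⟩ => .mono (scanChains_spec hv hM) (fun υ hF' hυ => ?_) le_rfl) ?_
  · have htab : τ.table = σ.table := hF.table (by decide) (by decide)
    rw [← htab] at hO hW hM ⊢
    exact insertElement_spec hv ((hF.var (by decide)).trans hn) hO hW hr hM hc
  · rw [show υ.arr .prv = τ.arr .prv from hF'.arr (by decide)]
    exact ⟨hυ.1.eq_chainCount.trans_le hc, hM, hυ.1⟩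
  · have h1 : n + 1 ≤ (w + 2) ^ 3 * (n + 1) := Nat.le_mul_of_pos_left _ (by positivity)
    simp only [PExpr.cost]
    nlinarith

/-! ## Reading the input -/

/-- Copy the first `size` memory cells into the array `inp`. The copy of a cell never stands below
the cell itself, so going downwards overwrites only cells that have already been copied. -/
def copyInput : PStmt :=
  set .hi Var.size ;; loop Var.size (set .hi (Var.hi - 1) ;; put .inp Var.hi (raw Var.hi))

theorem copyInput_spec {σ : PState} {L : ℕ} (hL : σ.var .size = L) (h0 : ∀ a ≥ L, σ.mem a = 0) :
    copyInput.Spec σ (fun τ => τ.arr .inp = σ.mem) (50 * (L + 1)) := by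
  refine .le (.set_seq <| .mono (Spec.loop (N := L) (B := 30) (fun r τ => τ.var .hi = L - r ∧
    (∀ a ≥ L - r, τ.arr .inp a = σ.mem a) ∧ ∀ a < L - r, τ.mem a = σ.mem a) hL
    ⟨by simp [hL], fun a ha => ?_, fun _ _ => rfl⟩ fun r hr τ _ ⟨hhi, hge, hlt⟩ =>
    .of_loopFree rfl (by decide) ?_) (fun τ _ h => funext fun a => h.2.1 a (by lia)) le_rfl) ?_
  · rw [Nat.sub_zero] at ha
    rw [h0 a ha]
    exact h0 _ (ha.trans (by lia))
  · have hpred : L - r - 1 = L - (r + 1) := by lia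
    simp only [run_seq, run_set, run_put, PState.setArr_var, PState.setVar_var, PState.setArr_arr,
      PState.setVar_arr, PState.setVar_mem, eval_var, eval_sub, eval_ofNat, eval_raw, if_true, hhi,
      hpred]
    refine ⟨trivial, fun a ha => ?_, fun a ha => ?_⟩
    · rcases ha.eq_or_lt with rfl | ha
      · rw [Function.update_self]
        exact hlt _ (by lia)
      · rw [Function.update_of_ne ha.ne']
        exact hge a (by lia)
    · rw [← hlt a (by lia)]
      exact Function.update_of_ne (by lia) ..
  · simp only [PExpr.cost]
    lia

/-- Read the three numbers at the beginning of the input, and move the input into the array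
`inp`. -/
def readInput : PStmt :=
  set .n (raw 0) ;; set .q (raw 1) ;; set .len (raw 2) ;; set .size (Var.len + 3) ;;
  loop Var.n (set .size (Var.size + Var.n)) ;; copyInput

theorem readInput_spec {σ : PState} {n q len : ℕ} (hn : σ.mem 0 = n) (hq : σ.mem 1 = q)
    (hlen : σ.mem 2 = len) (h0 : ∀ a ≥ len + 3 + n * n, σ.mem a = 0) :
    readInput.Spec σ (fun τ => τ.var .n = n ∧ τ.var .q = q ∧ τ.var .len = len ∧
      τ.var .size = len + 3 + n * n ∧ τ.arr .inp = σ.mem) (300 * (len + 1) * (n + 1) ^ 2) := by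
  refine .le (.set_seq <| .set_seq <| .set_seq <| .set_seq <| .seq
    (Spec.loop (N := n) (B := 10)
      (fun r τ => τ.var .size = len + 3 + r * n ∧ τ.mem = σ.mem) ?_ ?_ fun _ _ τ hF ⟨hs, hm⟩ =>
      .of_loopFree rfl (by decide) ?_)
    fun τ hF ⟨hs, hm⟩ => .mono (copyInput_spec hs (hm ▸ h0)) (fun υ hF' h => ?_) le_rfl) ?_
  · simp [hn]
  · simp [hlen]
  · have hn' : τ.var .n = n := (hF.var (by decide)).trans (by simp [hn])
    simp only [run_set, PState.setVar_var, PState.setVar_mem, eval_add, eval_var, if_true, hs, hn',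
      hm, and_true]
    ring
  · refine ⟨?_, ?_, ?_, (hF'.var (by decide)).trans hs, h.trans hm⟩
    · exact (hF'.var (by decide)).trans ((hF.var (by decide)).trans (by simp [hn]))
    · exact (hF'.var (by decide)).trans ((hF.var (by decide)).trans (by simp [hq]))
    · exact (hF'.var (by decide)).trans ((hF.var (by decide)).trans (by simp [hlen]))
  · simp only [PExpr.cost]
    lia

/-- Let the array `r` contain the addresses of the rows of a matrix with rows of length `width`
that is stored from address `start` on. -/
def findRows (r : Arr) (start : ℕ) (width : Var) : PStmt :=
  set .acc (.const start) ;;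
  forTo .i width (put r Var.i Var.acc ;; set .acc (Var.acc + width))

theorem findRows_spec {σ : PState} (r : Arr) (start : ℕ) {width : Var} {n : ℕ}
    (hn : σ.var width = n) (hi : width ≠ .i) (hacc : width ≠ .acc) :
    (findRows r start width).Spec σ (fun τ => ∀ a < n, τ.arr r a = start + a * n)
      (50 * (n + 1)) := by
  refine .le (.set_seq <| .mono (Spec.forTo (x := .i) (N := n) (B := 30)
    (fun a τ => τ.var .acc = start + a * n ∧ ∀ b < a, τ.arr r b = start + b * n)
    (by simp [vars]) (by simp [hn, hi, hacc]) (fun _ _ _ h => h) ⟨?_, nofun⟩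
    fun a ha τ hF hia ⟨hτ, hrow⟩ => .of_loopFree rfl (by simp [bound, PExpr.cost]) ?_)
    (fun τ _ h => h.2) le_rfl) ?_
  · simp [PExpr.eval]
  · have hn' : τ.var width = n :=
      (hF.var (by simp [forTo, vars, hi, hacc])).trans (by simp [hn, hacc])
    simp only [run_seq, run_put, run_set, PState.setVar_var, PState.setVar_arr, PState.setArr_var,
      PState.setArr_arr, eval_add, eval_var, if_true, hia, hτ, hn']
    refine ⟨by ring, fun b hb => ?_⟩
    rcases Nat.lt_succ_iff_lt_or_eq.1 hb with hb | rfl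
    · rw [Function.update_of_ne hb.ne]
      exact hrow b hb
    · exact Function.update_self ..
  · simp only [PExpr.cost]
    lia

/-! ## Evaluating the quantifier-free part -/

namespace QFFormula

theorem length_encode_le {q : ℕ} (ψ : QFFormula q) : ψ.encode.length ≤ ψ.size := by
  induction ψ <;> simp_all only [encode, size, List.length_append, List.length_cons,
    List.length_nil] <;> lia

/-- The number of atoms and connectives of a formula. -/
def numTokens {q : ℕ} : QFFormula q → ℕ
  | and ψ₁ ψ₂ => ψ₁.numTokens + ψ₂.numTokens + 1
  | or ψ₁ ψ₂ => ψ₁.numTokens + ψ₂.numTokens + 1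
  | _ => 1

theorem numTokens_le_length_encode {q : ℕ} (ψ : QFFormula q) :
    ψ.numTokens ≤ ψ.encode.length := by
  induction ψ <;> simp_all only [encode, numTokens, List.length_append, List.length_cons,
    List.length_nil] <;> lia

end QFFormula

/-- An expression for the conjunction of two truth values, where `0` is false and all other numbers
are true. -/
def PExpr.conj (a b : PExpr) : PExpr := 1 - ((1 - a) + (1 - b))

theorem PExpr.eval_conj (σ : PState) (a b : PExpr) :
    (conj a b).eval σ = if a.eval σ ≠ 0 ∧ b.eval σ ≠ 0 then 1 else 0 := by
  simp only [conj, eval_sub, eval_add, eval_ofNat]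
  split <;> lia

/-- An expression for the negation of a truth value. -/
def PExpr.neg (a : PExpr) : PExpr := 1 - a

theorem PExpr.eval_neg (σ : PState) (a : PExpr) :
    a.neg.eval σ = if a.eval σ ≠ 0 then 0 else 1 := by
  simp only [neg, eval_sub, eval_ofNat]
  split <;> lia

/-- Replace the two truth values on top of the stack by the result of the connective `tok`. -/
def evalConnective : PStmt :=
  set .sp (Var.sp - 1) ;; set .elt (get .stk (Var.sp - 1)) ;; set .tgt (get .stk Var.sp) ;;
  ite (Var.tok - 4) (put .stk (Var.sp - 1) (Var.elt + Var.tgt))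
    (put .stk (Var.sp - 1) (conj Var.elt Var.tgt)) ;;
  set .pos (Var.pos + 1)

/-- Push the truth value of a literal of type `tok` on the stack. -/
def evalLiteral : PStmt :=
  set .i (get .inp (Var.pos + 1)) ;; set .j (get .inp (Var.pos + 2)) ;;
  set .elt (get .con (get .qrow Var.i + Var.j)) ;;
  set .tgt (conj Var.elt (get .con (get .qrow Var.j + Var.i))) ;;
  ite Var.tok (ite (Var.tok - 1) (ite (Var.tok - 2)
    (put .stk Var.sp (neg Var.elt)) (put .stk Var.sp (neg Var.tgt)))
    (put .stk Var.sp Var.elt)) (put .stk Var.sp Var.tgt) ;;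
  set .sp (Var.sp + 1) ;; set .pos (Var.pos + 3)

/-- Process the token at position `pos` of the input, if there is one. -/
def evalToken : PStmt :=
  ite (Var.size - Var.pos)
    (set .tok (get .inp Var.pos) ;; ite (Var.tok - 3) evalConnective evalLiteral)
    skip

/-- The effect of evaluating a formula with truth value `P` and a code of length `l`. -/
structure Pushed (σ τ : PState) (l : ℕ) (P : Prop) : Prop where
  pos : τ.var .pos = σ.var .pos + l
  sp : τ.var .sp = σ.var .sp + 1
  top : τ.arr .stk (σ.var .sp) ≠ 0 ↔ P
  stk : ∀ i < σ.var .sp, τ.arr .stk i = σ.arr .stk i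

/-- The list `l` stands in the array `inp` from position `pos` on. -/
def NextInput (σ : PState) (l : List ℕ) : Prop :=
  σ.var .pos + l.length ≤ σ.var .size ∧ ∀ i, ∀ h : i < l.length, σ.arr .inp (σ.var .pos + i) = l[i]

theorem NextInput.left {σ : PState} {l₁ l₂ : List ℕ} (h : NextInput σ (l₁ ++ l₂)) :
    NextInput σ l₁ := by
  have hlen := List.length_append ▸ h.1
  exact ⟨by lia, fun i hi => by
    rw [h.2 i (by rw [List.length_append]; lia), List.getElem_append_left hi]⟩

theorem NextInput.right {σ τ : PState} {l₁ l₂ : List ℕ} (h : NextInput σ (l₁ ++ l₂))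
    (hpos : τ.var .pos = σ.var .pos + l₁.length) (hsize : τ.var .size = σ.var .size)
    (hinp : τ.arr .inp = σ.arr .inp) : NextInput τ l₂ := by
  have hlen := List.length_append ▸ h.1
  refine ⟨by lia, fun i hi => ?_⟩
  rw [hinp, hpos, add_assoc, h.2 _ (by rw [List.length_append]; lia),
    List.getElem_append_right (by lia)]
  simp only [Nat.add_sub_cancel_left]

theorem pushed_evalLiteral {σ : PState} {c i j : ℕ} {P : Prop} (h : NextInput σ [c, i, j])
    (hc : c < 4)
    (hP : (if c = 0 then σ.arr .con (σ.arr .qrow i + j) ≠ 0 ∧ σ.arr .con (σ.arr .qrow j + i) ≠ 0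
      else if c = 1 then σ.arr .con (σ.arr .qrow i + j) ≠ 0
      else if c = 2 then
        ¬ (σ.arr .con (σ.arr .qrow i + j) ≠ 0 ∧ σ.arr .con (σ.arr .qrow j + i) ≠ 0)
      else ¬ σ.arr .con (σ.arr .qrow i + j) ≠ 0) ↔ P) :
    Pushed σ (evalToken.run σ) 3 P := by
  have hsize : σ.var .size - σ.var .pos ≠ 0 := Nat.sub_ne_zero_of_lt (by
    have := h.1
    rw [List.length_cons] at this
    lia)
  have h0 : σ.arr .inp (σ.var .pos) = c := h.2 0 (by simp)
  have h1 : σ.arr .inp (σ.var .pos + 1) = i := h.2 1 (by simp)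
  have h2 : σ.arr .inp (σ.var .pos + 2) = j := h.2 2 (by simp)
  rw [← hP]
  interval_cases c <;> constructor <;>
    simp +contextual [evalToken, evalLiteral, hsize, h0, h1, h2, eval_conj, eval_neg,
      ne_of_lt]

theorem pushed_evalConnective {σ τ υ : PState} {c l₁ l₂ : ℕ} {P₁ P₂ : Prop}
    (h₁ : Pushed σ τ l₁ P₁) (h₂ : Pushed τ υ l₂ P₂) (h : NextInput υ [c]) (hc : 4 ≤ c) :
    Pushed σ (evalToken.run υ) (l₁ + l₂ + 1) (if c = 4 then P₁ ∧ P₂ else P₁ ∨ P₂) := by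
  have hpos : υ.var .pos = σ.var .pos + (l₁ + l₂) :=
    h₂.pos.trans (by rw [h₁.pos, add_assoc])
  have hsize : υ.var .size - υ.var .pos ≠ 0 := Nat.sub_ne_zero_of_lt h.1
  have h0 : υ.arr .inp (υ.var .pos) = c := h.2 0 (by simp)
  rw [hpos] at hsize h0
  have hsp : υ.var .sp = σ.var .sp + 2 := h₂.sp.trans (by rw [h₁.sp])
  have hfst : υ.arr .stk (σ.var .sp) = τ.arr .stk (σ.var .sp) := h₂.stk _ (by rw [h₁.sp]; lia)
  have htop₂ := h₂.top
  rw [h₁.sp] at htop₂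
  have hstk (i : ℕ) (hi : i < σ.var .sp) : υ.arr .stk i = σ.arr .stk i :=
    (h₂.stk i (by rw [h₁.sp]; lia)).trans (h₁.stk i hi)
  rw [← h₁.top, ← htop₂]
  by_cases h4 : c = 4
  · constructor <;>
      simp +contextual [evalToken, evalConnective, hsize, h0, h4, hpos, hsp, hfst, eval_conj, hstk,
        ne_of_lt, add_assoc]
  · have hc3 : c - 3 ≠ 0 := by lia
    have hc4 : c - 4 ≠ 0 := by lia
    constructor <;>
      simp +contextual [evalToken, evalConnective, hsize, h0, h4, hc3, hc4, hpos, hsp, hfst,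
        hstk, ne_of_lt, add_assoc, imp_iff_not_or]

theorem pushed_iterate_evalToken {q : ℕ} (ψ : QFFormula q) {σ : PState}
    (h : NextInput σ ψ.encode) (hrow : ∀ i < q, σ.arr .qrow i = i * q) :
    Pushed σ (evalToken.run^[ψ.numTokens] σ) ψ.encode.length
      (ψ.Holds fun i j => σ.arr .con (i * q + j) ≠ 0) := by
  have hF (t : ℕ) (σ : PState) : evalToken.Frame σ (evalToken.run^[t] σ) :=
    .iterate evalToken.frame_run t σ
  induction ψ generalizing σ with
  | eq i j | le i j | ne i j | nle i j =>
    exact pushed_evalLiteral h (by lia) (by rw [hrow i i.2, hrow j j.2]; rfl)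
  | and ψ₁ ψ₂ ih₁ ih₂ | or ψ₁ ψ₂ ih₁ ih₂ =>
    have h₁ := ih₁ h.left.left hrow
    have hF₁ := hF ψ₁.numTokens σ
    have h₂ := ih₂ (h.left.right h₁.pos (hF₁.var (by decide)) (hF₁.arr (by decide)))
      (by rwa [hF₁.arr (by decide)])
    have hF₂ := hF₁.trans (hF ψ₂.numTokens _)
    rw [hF₁.arr (by decide)] at h₂
    have h₃ := pushed_evalConnective h₁ h₂ (h.right ((h₂.pos.trans (by rw [h₁.pos])).trans (by
      rw [List.length_append, add_assoc])) (hF₂.var (by decide)) (hF₂.arr (by decide))) (by lia)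
    rw [QFFormula.numTokens, Function.iterate_succ_apply', add_comm, Function.iterate_add_apply]
    simpa [QFFormula.encode, QFFormula.Holds, add_assoc] using h₃

/-- Evaluate the quantifier-free part, which stands at the end of the input; `con` tells the truth
values of the atoms. -/
def evalFormula : PStmt :=
  set .pos (Var.size - Var.len) ;; set .sp 0 ;; loop Var.len evalToken ;; set .val (get .stk 0)

theorem evalToken_run_of_le {σ : PState} (h : σ.var .size ≤ σ.var .pos) :
    evalToken.run σ = σ := by
  simp [evalToken, Nat.sub_eq_zero_of_le h]

theorem evalFormula_spec {q : ℕ} {ψ : QFFormula q} {σ : PState}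
    (hlen : σ.var .len = ψ.encode.length) (hsize : σ.var .len ≤ σ.var .size)
    (hinp : ∀ i, ∀ h : i < ψ.encode.length,
      σ.arr .inp (σ.var .size - σ.var .len + i) = ψ.encode[i])
    (hrow : ∀ i < q, σ.arr .qrow i = i * q) :
    evalFormula.Spec σ (fun τ => τ.var .val ≠ 0 ↔ ψ.Holds fun i j => σ.arr .con (i * q + j) ≠ 0)
      (500 * (σ.var .len + 1)) := by
  set σ₁ := (σ.setVar .pos (σ.var .size - σ.var .len)).setVar .sp 0 with hσ₁
  have hpos : σ₁.var .pos = σ.var .size - σ.var .len := by simp [hσ₁]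
  have hsize₁ : σ₁.var .size = σ.var .size := by simp [hσ₁]
  have hψ : Pushed σ₁ (evalToken.run^[ψ.numTokens] σ₁) _ _ :=
    pushed_iterate_evalToken ψ ⟨by lia, hpos ▸ hinp⟩ hrow
  have hfix : evalToken.run^[σ.var .len] σ₁ = evalToken.run^[ψ.numTokens] σ₁ := by
    rw [← Nat.sub_add_cancel (m := ψ.numTokens) (n := σ.var .len)
      (hlen ▸ ψ.numTokens_le_length_encode), Function.iterate_add_apply]
    refine Function.iterate_fixed (evalToken_run_of_le ?_) _
    rw [hψ.pos, hpos, (Frame.iterate evalToken.frame_run _ σ₁).var (by decide), hsize₁]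
    lia
  refine .le (.set_seq <| .set_seq <| .seq (Spec.loop (N := σ.var .len) (B := 400)
    (fun r τ => τ = evalToken.run^[r] σ₁) rfl rfl fun r _ τ _ hτ =>
    .of_loopFree rfl (by decide) (hτ ▸ (Function.iterate_succ_apply' ..).symm)) fun τ _ hτ =>
    .of_loopFree (B := 20) rfl (by decide) ?_) ?_
  · rw [hτ, hfix]
    simpa [hσ₁] using hψ.top
  · rw [show (var .size - var .len : PExpr).cost = 3 from rfl]
    simp only [PExpr.cost]
    lia

/-! ## Trying all guesses -/

/-- Write the binary digits of the guess into the array `con`. -/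
def writeBits : PStmt :=
  set .elt Var.guess ;;
  forTo .i Var.bits (put .con Var.i (Var.elt - (half Var.elt + half Var.elt)) ;;
    set .elt (half Var.elt))

theorem writeBits_spec {σ : PState} {g d : ℕ} (hg : σ.var .guess = g) (hd : σ.var .bits = d) :
    writeBits.Spec σ (fun τ => ∀ p < d, τ.arr .con p = digit g p) (100 * (d + 1)) := by
  refine .le (.set_seq <| .mono (Spec.forTo (x := .i) (N := d) (B := 40)
    (fun r τ => τ.var .elt = g / 2 ^ r ∧ ∀ p < r, τ.arr .con p = digit g p)
    (by decide) hd (fun _ _ _ h => h) (by simp [hg]) fun r _ τ _ hr ⟨helt, hcon⟩ =>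
    .of_loopFree rfl (by decide) ?_) (fun τ _ h => h.2) le_rfl) ?_
  · have hmod : g / 2 ^ r - (g / 2 ^ r / 2 + g / 2 ^ r / 2) = digit g r := by
      rw [digit]
      lia
    simp only [run_seq, run_put, run_set, PState.setVar_var, PState.setVar_arr, PState.setArr_var,
      PState.setArr_arr, eval_sub, eval_add, eval_half, eval_var, if_true, hr, helt, hmod]
    refine ⟨by rw [Nat.div_div_eq_div_mul, pow_succ], fun p hp => ?_⟩
    rcases Nat.lt_succ_iff_lt_or_eq.1 hp with hp | rfl
    · rw [Function.update_of_ne hp.ne]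
      exact hcon p hp
    · exact Function.update_self ..
  · simp only [PExpr.cost]
    lia

/-- The formula `ψ` and the table of a partial order on `{0, …, n - 1}` have been read. -/
structure InputData {q : ℕ} (ψ : QFFormula q) (n : ℕ) (σ : PState) : Prop where
  n_eq : σ.var .n = n
  q_eq : σ.var .q = q
  len_eq : σ.var .len = ψ.encode.length
  len_le : σ.var .len ≤ σ.var .size
  code : ∀ i, ∀ h : i < ψ.encode.length,
    σ.arr .inp (σ.var .size - σ.var .len + i) = ψ.encode[i]
  qrow : ∀ i < q, σ.arr .qrow i = i * q
  order : IsOrderTable σ.table n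

/-- The data on which the search for a solution works: the input, the numbers that describe the
shape of a guess, and a partition of the poset into `k` chains. -/
structure SearchData {q : ℕ} (ψ : QFFormula q) (n k : ℕ) (σ : PState) : Prop
    extends InputData ψ n σ where
  k_eq : σ.var .k = k
  qq_eq : σ.var .qq = q * q
  bits_eq : σ.var .bits = q * q + q * k
  matching : IsMatching σ.table (σ.arr .prv) n
  chains : IsChainData (σ.arr .prv) (σ.arr .nxt) (σ.arr .head) n k

section Search

variable {q n k : ℕ} {ψ : QFFormula q} {σ τ : PState}

theorem InputData.frame {s : PStmt} (h : InputData ψ n σ) (hF : s.Frame σ τ)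
    (hv : ∀ x ∈ [Var.n, .q, .len, .size], x ∉ s.vars)
    (ha : ∀ r ∈ [Arr.inp, .row, .qrow], r ∉ s.arrs) : InputData ψ n τ := by
  simp only [List.forall_mem_cons, List.not_mem_nil, false_imp_iff, implies_true, and_true] at hv ha
  obtain ⟨hn, hq, hlen, hsize⟩ := hv
  obtain ⟨hinp, hrow, hqrow⟩ := ha
  constructor
  · exact (hF.var hn).trans h.n_eq
  · exact (hF.var hq).trans h.q_eq
  · exact (hF.var hlen).trans h.len_eq
  · rw [hF.var hlen, hF.var hsize]
    exact h.len_le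
  · rw [hF.var hlen, hF.var hsize, hF.arr hinp]
    exact h.code
  · rw [hF.arr hqrow]
    exact h.qrow
  · rw [hF.table hinp hrow]
    exact h.order

theorem SearchData.frame {s : PStmt} (h : SearchData ψ n k σ) (hF : s.Frame σ τ)
    (hv : ∀ x ∈ [Var.n, .q, .k, .qq, .bits, .len, .size], x ∉ s.vars)
    (ha : ∀ r ∈ [Arr.inp, .row, .prv, .nxt, .head, .qrow], r ∉ s.arrs) :
    SearchData ψ n k τ where
  toInputData := h.toInputData.frame hF (by simp_all) (by simp_all)
  k_eq := (hF.var (hv .k (by decide))).trans h.k_eq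
  qq_eq := (hF.var (hv .qq (by decide))).trans h.qq_eq
  bits_eq := (hF.var (hv .bits (by decide))).trans h.bits_eq
  matching := by
    rw [hF.table (ha .inp (by decide)) (ha .row (by decide)), hF.arr (ha .prv (by decide))]
    exact h.matching
  chains := by
    rw [hF.arr (ha .prv (by decide)), hF.arr (ha .nxt (by decide)), hF.arr (ha .head (by decide))]
    exact h.chains

/-- Put each pointer at the least element of the chain that is guessed for it. -/
def placePointers : PStmt :=
  forTo .i Var.q (put .ptr Var.i (get .head 0)) ;; set .idx Var.qq ;;
  forGrid Var.q Var.k (ite (get .con Var.idx) (put .ptr Var.i (get .head Var.j)) skip)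

theorem placePointers_spec (h : SearchData ψ n k σ) (hk : 0 < k) :
    placePointers.Spec σ
      (fun τ => Placed q n k (σ.arr .con) (σ.arr .head) (q * k) (τ.arr .ptr))
      (100 * ((q + 1) * (k + 1))) := by
  refine .le (.seq (Spec.forTo (x := .i) (N := q) (B := 20) (fun r τ => ∀ i < r, τ.arr .ptr i < n)
    (by decide) h.q_eq (fun _ _ _ h => h) nofun fun r _ τ hF hr hlt =>
      .of_loopFree rfl (by decide) fun i hi => ?_) fun τ hF hlt => .set_seq <|
    Spec.forGrid (R := q) (C := k) (base := q * q) (B := 30)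
      (fun r τ => Placed q n k (σ.arr .con) (σ.arr .head) r (τ.arr .ptr)) (by decide)
      (fun υ hF' => (hF'.var (by decide)).trans ((hF.var (by decide)).trans h.q_eq))
      (fun υ hF' => (hF'.var (by decide)).trans ((hF.var (by decide)).trans h.k_eq))
      ((hF.var (by decide)).trans h.qq_eq) (fun _ _ _ h => ⟨h, h, h⟩) ⟨hlt, nofun⟩
      fun a _ b hb υ hF' ha hb' hidx hP => .of_loopFree rfl (by decide) ?_) ?_
  · have hhead : τ.arr .head = σ.arr .head := hF.arr (by decide)
    simp only [run_put, PState.setArr_arr, eval_get, eval_var, eval_ofNat, if_true, hr, hhead]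
    rcases Nat.lt_succ_iff_lt_or_eq.1 hi with hi | rfl
    · rw [Function.update_of_ne hi.ne]
      exact hlt i hi
    · rw [Function.update_self]
      exact h.chains.head_lt hk
  · have hcon : υ.arr .con = σ.arr .con := (hF'.arr (by decide)).trans (hF.arr (by decide))
    have hhead : υ.arr .head = σ.arr .head := (hF'.arr (by decide)).trans (hF.arr (by decide))
    simp only [run_ite, run_put, run_skip, eval_get, eval_var, ha, hb', hidx, hcon, hhead]
    split_ifs with h0
    · exact hP.skip hb h0
    · simpa only [PState.setArr_arr, if_true] using hP.update hb (h.chains.head_lt hb) h0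
  · simp only [PExpr.cost]
    nlinarith

/-- Move the pointers to a solution that agrees with the guess `con`, if there is one. -/
def checkGuess : PStmt :=
  set .m Var.q ;; ite Var.val (phase ;; ite Var.fail skip (set .res 1)) skip

theorem checkGuess_spec (h : SearchData ψ n k σ)
    (hP : Placed q n k (σ.arr .con) (σ.arr .head) (q * k) (σ.arr .ptr))
    (hcon : ∀ p < q * q, σ.arr .con p ≤ 1)
    (hval : σ.var .val ≠ 0 ↔ ψ.Holds fun i j => σ.arr .con (i * q + j) ≠ 0) :
    checkGuess.Spec σ (fun τ =>
      (τ.var .res = σ.var .res ∧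
        ¬GoodGuess ψ σ.table (σ.arr .nxt) (σ.arr .head) n k (σ.arr .con)) ∨
      (τ.var .res = 1 ∧ ψ.SatisfiedIn σ.table n)) (600 * (q + 1) ^ 3 * (n + 1)) := by
  have hN := h.chains.ascends h.matching
  refine .le (.set_seq <| .ite (B := 500 * (q + 1) ^ 3 * (n + 1) + 20) (fun hne =>
    .seq (phase_spec (m := q) (n := n) ?_ ?_ fun hR => hR.length_le h.order hN hP.lt)
      fun τ hF hτ => .of_loopFree (B := 20) rfl (by decide) ?_)
    fun hz => .of_loopFree rfl (Nat.zero_le _) (.inl ⟨rfl, ?_⟩)) ?_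
  · exact h.q_eq
  · exact h.n_eq
  · have hres : τ.var .res = σ.var .res := hF.var (by decide)
    obtain ⟨-, ⟨hf, hR, hA⟩ | ⟨hf, hR, ha, hb, hV, hx, -, -⟩⟩ := hτ
    · refine .inr ⟨by simp [hf], satisfiedIn_of_allHold h.order (hR.ptr_lt h.order hN hP.lt) hcon
        hA (hval.1 hne)⟩
    · refine .inl ⟨by simp [hf, hres], fun hG => ?_⟩
      obtain ⟨x, hx'⟩ := hG.exists_nxt h.order hN hP hR ha hb hV
      exact absurd (hx.symm.trans hx') (Nat.succ_ne_zero x).symm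
  · rintro ⟨s, c, hs⟩
    exact hval.2 (hs.holds_con h.order) hz
  · have : 1 ≤ (q + 1) ^ 3 * (n + 1) := Nat.mul_pos (by positivity) n.succ_pos
    simp only [PExpr.cost]
    lia

/-- Decode a guess: compute its digits, the truth value of the formula and the first positions of
the pointers. -/
def decodeGuess : PStmt := writeBits ;; evalFormula ;; placePointers

theorem decodeGuess_spec {g : ℕ} (h : SearchData ψ n k σ) (hk : 0 < k)
    (hg : σ.var .guess = g) :
    decodeGuess.Spec σ (fun τ => (∀ p < q * q + q * k, τ.arr .con p = digit g p) ∧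
      (τ.var .val ≠ 0 ↔ ψ.Holds fun i j => τ.arr .con (i * q + j) ≠ 0) ∧
      Placed q n k (τ.arr .con) (τ.arr .head) (q * k) (τ.arr .ptr))
      (100 * (q * q + q * k + 1) + (500 * (ψ.encode.length + 1) + 100 * ((q + 1) * (k + 1)))) := by
  refine .seq (writeBits_spec hg h.bits_eq) fun σ₁ hF₁ hcon => ?_
  have h₁ := h.frame hF₁ (by decide) (by decide)
  refine .seq ((evalFormula_spec h₁.len_eq h₁.len_le h₁.code h₁.qrow).le (by rw [h₁.len_eq]))
    fun σ₂ hF₂ hval => ?_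
  have h₂ := h₁.frame hF₂ (by decide) (by decide)
  refine (placePointers_spec h₂ hk).mono (fun τ hF₃ hP => ?_) le_rfl
  have hcon₂ : σ₂.arr .con = σ₁.arr .con := hF₂.arr (by decide)
  have hcon₃ : τ.arr .con = σ₂.arr .con := hF₃.arr (by decide)
  have hhead₃ : τ.arr .head = σ₂.arr .head := hF₃.arr (by decide)
  have hval₃ : τ.var .val = σ₂.var .val := hF₃.var (by decide)
  rw [hhead₃, hval₃, hcon₃]
  exact ⟨hcon₂ ▸ hcon, hcon₂ ▸ hval, hP⟩

/-- Try one guess. -/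
def tryGuess : PStmt := decodeGuess ;; checkGuess ;; set .guess (Var.guess + 1)

/-- The cost of trying one guess, up to a factor linear in the size of the poset. -/
def guessCost (q k len : ℕ) : ℕ :=
  1000 * ((q * q + q * k + 1) + (len + 1) + (q + 1) * (k + 1) + (q + 1) ^ 3)

theorem tryGuess_spec {g : ℕ} (h : SearchData ψ n k σ) (hk : 0 < k) (hg : σ.var .guess = g) :
    tryGuess.Spec σ (fun τ => τ.var .guess = g + 1 ∧
      ((τ.var .res = σ.var .res ∧ ¬∀ con, (∀ p < q * q + q * k, con p = digit g p) →
        GoodGuess ψ σ.table (σ.arr .nxt) (σ.arr .head) n k con) ∨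
      (τ.var .res = 1 ∧ ψ.SatisfiedIn σ.table n)))
      (guessCost q k ψ.encode.length * (n + 1)) := by
  refine .le (.seq (decodeGuess_spec h hk hg) fun σ₁ hF₁ ⟨hcon, hval, hP⟩ =>
    .seq (checkGuess_spec (h.frame hF₁ (by decide) (by decide)) hP (fun p hp => ?_) hval)
    fun σ₂ hF₂ hσ₂ => .of_loopFree (B := 10) rfl (by decide) ⟨?_, ?_⟩) ?_
  · rw [hcon p (by lia), digit]
    lia
  · have hg₂ : σ₂.var .guess = g := (hF₂.var (by decide)).trans ((hF₁.var (by decide)).trans hg)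
    simp [hg₂]
  · have hres : σ₁.var .res = σ.var .res := hF₁.var (by decide)
    have htab : σ₁.table = σ.table := hF₁.table (by decide) (by decide)
    have hnxt : σ₁.arr .nxt = σ.arr .nxt := hF₁.arr (by decide)
    have hhead : σ₁.arr .head = σ.arr .head := hF₁.arr (by decide)
    rw [hres, htab, hnxt, hhead] at hσ₂
    exact hσ₂.imp_left fun ⟨heq, hG⟩ => ⟨heq, fun h => hG (h _ hcon)⟩
  · rw [guessCost]
    generalize q * q + q * k + 1 = a, (q + 1) * (k + 1) = b
    have : 1 ≤ (q + 1) ^ 3 := Nat.one_le_pow _ _ q.succ_pos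
    nlinarith [Nat.zero_le (a * n), Nat.zero_le (b * n), Nat.zero_le (ψ.encode.length * n)]

/-- Try all guesses. Without chains, the poset is empty and does not satisfy any formula. -/
def searchAll : PStmt :=
  set .res 0 ;; set .guess 0 ;; ite Var.k (loop Var.acc tryGuess) skip

theorem QFFormula.numVars_pos {q : ℕ} (ψ : QFFormula q) : 0 < q := by
  induction ψ with
  | eq i | le i | ne i | nle i => exact i.pos
  | and _ _ ih | or _ _ ih => exact ih

theorem SearchData.not_satisfiedIn (h : SearchData ψ n 0 σ) : ¬ψ.SatisfiedIn σ.table n := by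
  rintro ⟨s, hs, -⟩
  obtain ⟨j, hj, -⟩ := h.chains.exists_chainReach h.order h.matching (hs 0 ψ.numVars_pos)
  exact j.not_lt_zero hj

open Classical in
theorem searchAll_spec (h : SearchData ψ n k σ) (hacc : σ.var .acc = 2 ^ (q * q + q * k)) :
    searchAll.Spec σ (fun τ => τ.var .res = if ψ.SatisfiedIn σ.table n then 1 else 0)
      (10 + 2 ^ (q * q + q * k) * (guessCost q k ψ.encode.length * (n + 1) + 4)) := by
  have h₁ : SearchData ψ n k ((σ.setVar .res 0).setVar .guess 0) :=
    h.frame ((set .res 0 ;; set .guess 0).frame_run σ) (by decide) (by decide)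
  refine .le (.set_seq <| .set_seq <| .ite (B := 3 + _) (fun hne => .mono (.loop
    (N := 2 ^ (q * q + q * k)) (B := guessCost q k ψ.encode.length * (n + 1)) (fun r τ =>
      τ.var .guess = r ∧
      ((τ.var .res = 0 ∧ ∀ g < r, ¬∀ con, (∀ p < q * q + q * k, con p = digit g p) →
        GoodGuess ψ σ.table (σ.arr .nxt) (σ.arr .head) n k con) ∨
      (τ.var .res = 1 ∧ ψ.SatisfiedIn σ.table n))) hacc ⟨rfl, .inl ⟨rfl, nofun⟩⟩
      fun r hr τ hF ⟨hg, hτ⟩ => ?_) (fun τ _ ⟨_, hτ⟩ => ?_) le_rfl)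
    fun hz => .of_loopFree rfl (Nat.zero_le _) ?_) ?_
  · have h₂ := h₁.frame hF (by decide) (by decide)
    refine (tryGuess_spec h₂ (Nat.pos_of_ne_zero (h.k_eq ▸ hne)) hg).mono
      (fun υ _ ⟨hg', hυ⟩ => ⟨hg', ?_⟩) le_rfl
    have htab : τ.table = σ.table := hF.table (by decide) (by decide)
    have hnxt : τ.arr .nxt = σ.arr .nxt := hF.arr (by decide)
    have hhead : τ.arr .head = σ.arr .head := hF.arr (by decide)
    rw [htab, hnxt, hhead] at hυ
    obtain ⟨heq, hG⟩ | hυ := hυ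
    · rw [heq]
      refine hτ.imp_left fun ⟨h0, hall⟩ => ⟨h0, fun g hgr => ?_⟩
      rcases Nat.lt_succ_iff_lt_or_eq.1 hgr with hgr | rfl
      · exact hall g hgr
      · exact hG
    · exact .inr hυ
  · obtain ⟨h0, hall⟩ | ⟨h1, hs⟩ := hτ
    · rw [h0, if_neg]
      intro hs
      obtain ⟨g, hg, hG⟩ := exists_goodGuess h.order h.matching h.chains hs
      exact hall g hg hG
    · rw [h1, if_pos hs]
  · obtain rfl : k = 0 := h.k_eq ▸ hz
    rw [if_neg h.not_satisfiedIn]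
    rfl
  · simp only [PExpr.cost]
    lia

end Search

/-! ## Searching for a solution -/

/-- Add `e` times the variable `y` to the variable `x`. -/
def addMultiple (x y : Var) (e : PExpr) : PStmt := loop e (set x (x + y))

theorem addMultiple_spec {σ : PState} {x y : Var} {e : PExpr} {N : ℕ} (hxy : x ≠ y)
    (hN : e.eval σ = N) :
    (addMultiple x y e).Spec σ (fun τ => τ.var x = σ.var x + N * σ.var y)
      (e.cost + 2 + N * 8) := by
  refine .loop (B := 4) (fun r τ => τ.var x = σ.var x + r * σ.var y) hN (by simp)
    fun r _ τ hF hτ => .of_loopFree rfl le_rfl ?_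
  have hy : τ.var y = σ.var y := hF.var (by simpa [vars] using hxy.symm)
  simp only [run_set, PState.setVar_var, eval_add, eval_var, if_true, hτ, hy]
  ring

/-- Compute the number of binary digits of a guess. -/
def countDigits : PStmt :=
  set .k Var.m ;; set .qq 0 ;; addMultiple .qq .q Var.q ;; set .bits Var.qq ;;
  addMultiple .bits .k Var.q

theorem countDigits_spec {σ : PState} {q k : ℕ} (hq : σ.var .q = q) (hk : σ.var .m = k) :
    countDigits.Spec σ (fun τ => τ.var .k = k ∧ τ.var .qq = q * q ∧ τ.var .bits = q * q + q * k)
      (50 * (q + 1)) := by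
  refine .le (.set_seq <| .set_seq <| .seq (addMultiple_spec (by decide) hq) fun τ hF hqq =>
    .set_seq <| .mono (addMultiple_spec (N := q) (by decide) ?_)
      (fun υ hF' hbits => ?_) le_rfl) ?_
  · exact (hF.var (by decide)).trans hq
  · have hk' : τ.var .k = k := (hF.var (by decide)).trans hk
    have hqq' : τ.var .qq = q * q := by simpa [hq] using hqq
    exact ⟨(hF'.var (by decide)).trans hk', (hF'.var (by decide)).trans hqq',
      by simpa [hk', hqq'] using hbits⟩
  · simp only [PExpr.cost]
    lia

/-- Compute the number of guesses. -/
def countGuesses : PStmt := set .acc 1 ;; loop Var.bits (set .acc (Var.acc + Var.acc))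

theorem countGuesses_spec {σ : PState} {d : ℕ} (hd : σ.var .bits = d) :
    countGuesses.Spec σ (fun τ => τ.var .acc = 2 ^ d) (20 * (d + 1)) := by
  refine .le (.set_seq <| .loop (N := d) (B := 10) (fun r τ => τ.var .acc = 2 ^ r) hd rfl
    fun r _ τ _ hacc => .of_loopFree rfl (by decide) ?_) ?_
  · simp only [run_set, PState.setVar_var, eval_add, eval_var, if_true, hacc]
    ring
  · simp only [PExpr.cost]
    lia

/-- Decide whether the formula is satisfied, given a partition of the poset into chains. -/
def search : PStmt := countDigits ;; countGuesses ;; searchAll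

/-- A bound for the cost of the search per element of the poset. -/
def searchCost (q k len : ℕ) : ℕ :=
  100 * (q * q + q * k + q + 1) + 2 ^ (q * q + q * k) * (guessCost q k len + 4)

theorem searchCost_mono {q q' k k' len len' : ℕ} (hq : q ≤ q') (hk : k ≤ k') (hlen : len ≤ len') :
    searchCost q k len ≤ searchCost q' k' len' := by
  unfold searchCost guessCost
  gcongr
  exact one_le_two

open Classical in
theorem search_spec {q n k : ℕ} {ψ : QFFormula q} {σ : PState} (hI : InputData ψ n σ)
    (hk : σ.var .m = k) (hM : IsMatching σ.table (σ.arr .prv) n)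
    (hC : IsChainData (σ.arr .prv) (σ.arr .nxt) (σ.arr .head) n k) :
    search.Spec σ (fun τ => τ.var .res = if ψ.SatisfiedIn σ.table n then 1 else 0)
      (searchCost q k ψ.encode.length * (n + 1)) := by
  refine .le (.seq (countDigits_spec hI.q_eq hk) fun τ hF ⟨hk', hqq, hbits⟩ =>
    .seq (countGuesses_spec hbits) fun υ hF' hacc => ?_) (B := 50 * (q + 1) +
      (20 * (q * q + q * k + 1) +
        (10 + 2 ^ (q * q + q * k) * (guessCost q k ψ.encode.length * (n + 1) + 4)))) ?_
  · have htab : υ.table = σ.table :=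
      (hF'.table (by decide) (by decide)).trans (hF.table (by decide) (by decide))
    have harr : ∀ r, υ.arr r = σ.arr r := fun r =>
      (hF'.arr List.not_mem_nil).trans (hF.arr List.not_mem_nil)
    rw [← htab] at hM ⊢
    rw [← harr, ← harr .nxt, ← harr .head] at hC
    exact searchAll_spec ⟨(hI.frame hF (by decide) (by decide)).frame hF' (by decide) (by decide),
      (hF'.var (by decide)).trans hk', (hF'.var (by decide)).trans hqq,
      (hF'.var (by decide)).trans hbits, harr .prv ▸ hM, hC⟩ hacc
  · have hmul (c : ℕ) : c ≤ c * (n + 1) := Nat.le_mul_of_pos_right c n.succ_pos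
    calc 50 * (q + 1) + (20 * (q * q + q * k + 1) +
          (10 + 2 ^ (q * q + q * k) * (guessCost q k ψ.encode.length * (n + 1) + 4)))
      _ ≤ 100 * (q * q + q * k + q + 1) +
          2 ^ (q * q + q * k) * (guessCost q k ψ.encode.length * (n + 1) + 4) := by lia
      _ ≤ 100 * (q * q + q * k + q + 1) * (n + 1) +
          2 ^ (q * q + q * k) * (guessCost q k ψ.encode.length * (n + 1) + 4 * (n + 1)) := by
        exact Nat.add_le_add (hmul _) (Nat.mul_le_mul_left _ (Nat.add_le_add_left (hmul 4) _))
      _ = searchCost q k ψ.encode.length * (n + 1) := by rw [searchCost]; ring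

/-! ## Posets as tables -/

open Classical in
/-- `tab` is the 0/1-table of the order of `P`, where `e` lists the elements of `P`. -/
def IsTableOf {P : Type*} [PartialOrder P] {n : ℕ} (e : Fin n ≃ P) (tab : ℕ → ℕ → ℕ) : Prop :=
  ∀ a b : Fin n, tab a b = if e a ≤ e b then 1 else 0

section IsTableOf

variable {P : Type*} [PartialOrder P] {n : ℕ} {e : Fin n ≃ P} {tab : ℕ → ℕ → ℕ}

theorem IsTableOf.eq_one_iff (h : IsTableOf e tab) (a b : Fin n) : tab a b = 1 ↔ e a ≤ e b := by
  rw [h a b]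
  split <;> simp_all

theorem IsTableOf.isOrderTable (h : IsTableOf e tab) : IsOrderTable tab n where
  le_one a ha b hb := by
    rw [h ⟨a, ha⟩ ⟨b, hb⟩]
    split <;> decide
  refl a ha := (h.eq_one_iff ⟨a, ha⟩ ⟨a, ha⟩).2 le_rfl
  trans a ha b hb c hc hab hbc := (h.eq_one_iff ⟨a, ha⟩ ⟨c, hc⟩).2
    (((h.eq_one_iff ⟨a, ha⟩ ⟨b, hb⟩).1 hab).trans ((h.eq_one_iff ⟨b, hb⟩ ⟨c, hc⟩).1 hbc))
  antisymm a ha b hb hab hba := congrArg Fin.val (e.injective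
    (((h.eq_one_iff ⟨a, ha⟩ ⟨b, hb⟩).1 hab).antisymm ((h.eq_one_iff ⟨b, hb⟩ ⟨a, ha⟩).1 hba)))

theorem card_le_posetWidth [Finite P] {A : Finset P} (hA : IsAntichain (· ≤ ·) (A : Set P)) :
    A.card ≤ posetWidth P := by
  have := Fintype.ofFinite P
  refine le_csSup ⟨Fintype.card P, ?_⟩ ⟨A, hA, rfl⟩
  rintro _ ⟨B, -, rfl⟩
  exact Finset.card_le_univ B

theorem IsTableOf.widthLE (h : IsTableOf e tab) : WidthLE tab n (posetWidth P) := by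
  intro m f hf hanti
  have : Finite P := .of_equiv _ e
  let g : Fin m → P := fun i => e ⟨f i, hf i i.2⟩
  have hg : ∀ i j, g i ≤ g j → i = j := fun i j hle => by
    by_contra hij
    exact hanti i i.2 j j.2 (Fin.val_ne_of_ne hij) ((h.eq_one_iff ⟨f i, _⟩ ⟨f j, _⟩).2 hle)
  let A : Finset P := Finset.univ.map ⟨g, fun i j hij => hg i j hij.le⟩
  have hA : IsAntichain (· ≤ ·) (A : Set P) := by
    intro x hx y hy hxy hle
    obtain ⟨i, -, rfl⟩ := Finset.mem_map.1 hx
    obtain ⟨j, -, rfl⟩ := Finset.mem_map.1 hy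
    exact hxy (congrArg g (hg i j hle))
  simpa [A] using card_le_posetWidth hA

theorem QFFormula.realize_toFormula {q : ℕ} (ψ : QFFormula q) {v : Empty → P} {s : Fin q → P}
    {M : ℕ → ℕ → Prop} (hM : ∀ i j : Fin q, M i j ↔ s i ≤ s j) :
    @FirstOrder.Language.BoundedFormula.Realize FirstOrder.Language.order P
      (FirstOrder.Language.orderStructure P) _ _ ψ.toFormula v s ↔ ψ.Holds M := by
  let := FirstOrder.Language.orderStructure P
  have : FirstOrder.Language.order.OrderedStructure P := ⟨fun _ => Iff.rfl⟩
  induction ψ with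
  | eq i j => simp [toFormula, Holds, le_antisymm_iff, hM]
  | le i j => simp [toFormula, Holds, hM]
  | ne i j => simp [toFormula, Holds, le_antisymm_iff, hM]
  | nle i j => simp [toFormula, Holds, hM]
  | and ψ₁ ψ₂ h₁ h₂ => simp [toFormula, Holds, h₁, h₂]
  | or ψ₁ ψ₂ h₁ h₂ => simp [toFormula, Holds, h₁, h₂]

theorem IsTableOf.models_iff (h : IsTableOf e tab) (φ : ExSentence) :
    φ.Models P ↔ φ.body.SatisfiedIn tab n := by
  let := FirstOrder.Language.orderStructure P
  rw [ExSentence.Models, FirstOrder.Language.Sentence.Realize, ExSentence.toSentence,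
    FirstOrder.Language.BoundedFormula.realize_exs]
  constructor
  · rintro ⟨s, hs⟩
    refine ⟨fun i => if h : i < φ.q then e.symm (s ⟨i, h⟩) else 0, fun i hi => by simp [hi],
      (φ.body.realize_toFormula fun i j => ?_).1 hs⟩
    simpa using h.eq_one_iff (e.symm (s i)) (e.symm (s j))
  · rintro ⟨s, hs, hψ⟩
    exact ⟨fun i => e ⟨s i, hs i i.2⟩, (φ.body.realize_toFormula fun i j =>
      h.eq_one_iff ⟨s i, hs i i.2⟩ ⟨s j, hs j j.2⟩).2 hψ⟩

open Classical in
theorem orderTable_eq_ofFn (e : Fin n ≃ P) : orderTable e =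
    List.ofFn fun p : Fin (n * n) => if e p.divNat ≤ e p.modNat then 1 else 0 := by
  simp only [List.ofFn_mul, List.ofFn_eq_map, orderTable, List.flatMap, Fin.divNat, Fin.modNat,
    mul_add_div_of_lt (Fin.is_lt _), Nat.mul_add_mod_of_lt (Fin.is_lt _), Fin.eta]

theorem length_orderTable (e : Fin n ≃ P) : (orderTable e).length = n * n := by
  rw [orderTable_eq_ofFn, List.length_ofFn]

theorem length_encodeInstance (φ : ExSentence) (e : Fin n ≃ P) :
    (encodeInstance φ e).length = φ.body.encode.length + 3 + n * n := by
  simp only [encodeInstance, List.length_cons, List.length_append, length_orderTable]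
  lia

theorem isTableOf_encodeInstance (φ : ExSentence) (e : Fin n ≃ P) :
    IsTableOf e fun a b => (encodeInstance φ e).getD (3 + a * n + b) 0 := by
  intro a b
  have hab : (a * n + b : ℕ) < n * n := mul_add_lt_mul a.2 b.2
  change (encodeInstance φ e).getD (3 + a * n + b) 0 = _
  rw [show 3 + (a : ℕ) * n + b = a * n + b + 1 + 1 + 1 by lia, encodeInstance,
    List.getD_cons_succ, List.getD_cons_succ, List.getD_cons_succ,
    List.getD_append _ _ _ _ (by rwa [length_orderTable]), orderTable_eq_ofFn,
    List.getD_eq_getElem _ _ (by rwa [List.length_ofFn]), List.getElem_ofFn]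
  have hdiv : Fin.divNat ⟨a * n + b, hab⟩ = a := Fin.ext (mul_add_div_of_lt b.2)
  have hmod : Fin.modNat ⟨a * n + b, hab⟩ = b := Fin.ext (Nat.mul_add_mod_of_lt b.2)
  rw [hdiv, hmod]

theorem getD_encodeInstance_code (φ : ExSentence) (e : Fin n ≃ P) {i : ℕ}
    (hi : i < φ.body.encode.length) :
    (encodeInstance φ e).getD (3 + n * n + i) 0 = φ.body.encode[i] := by
  rw [show 3 + n * n + i = n * n + i + 1 + 1 + 1 by lia, encodeInstance, List.getD_cons_succ,
    List.getD_cons_succ, List.getD_cons_succ,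
    List.getD_append_right _ _ _ _ (by rw [length_orderTable]; lia), length_orderTable,
    Nat.add_sub_cancel_left, List.getD_eq_getElem _ _ hi]

end IsTableOf

/-! ## Model checking -/

/-- Read the input, and find the rows of the order table and of the table in which a guess stores
the order of the witnesses. -/
def loadInput : PStmt := readInput ;; findRows .row 3 .n ;; findRows .qrow 0 .q

/-- The model checking algorithm. -/
def modelCheck : PStmt := loadInput ;; coverByChains ;; search

/-- The factor of the running time that depends on the size `s` of the sentence and the width `w` of
the poset, but not on its cardinality. -/
def timeFactor (s w : ℕ) : ℕ :=
  500 * (s + 1) + 1500 * (w + 2) ^ 3 + searchCost s w s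

theorem ExSentence.q_le_size (φ : ExSentence) : φ.q ≤ φ.size := by
  unfold size
  lia

theorem ExSentence.length_encode_le_size (φ : ExSentence) : φ.body.encode.length ≤ φ.size :=
  φ.body.length_encode_le.trans (Nat.le_add_left _ _)

section ModelCheck

variable {P : Type*} [PartialOrder P] {n : ℕ}

theorem loadInput_spec (φ : ExSentence) (e : Fin n ≃ P) :
    loadInput.Spec (.start (encodeInstance φ e))
      (fun τ => InputData φ.body n τ ∧ IsTableOf e τ.table) (450 * (φ.size + 1) * (n + 1) ^ 2) := by
  refine .le (.seq (readInput_spec (n := n) (q := φ.q) (len := φ.body.encode.length) rfl rfl rfl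
    fun a ha => List.getD_eq_default _ _ ((length_encodeInstance φ e).trans_le ha))
    fun τ _ ⟨hn, hq, hlen, hsize, hinp⟩ => .seq (findRows_spec .row 3 hn (by decide) (by decide))
    fun υ hF hrow => .mono (findRows_spec (n := φ.q) .qrow 0 ?_ (by decide) (by decide))
      (fun ω hF' hqrow => ?_) le_rfl) ?_
  · exact (hF.var (by decide)).trans hq
  · have hvar : ∀ x ∈ [Var.n, .q, .len, .size], ω.var x = τ.var x := fun x hx =>
      (hF'.var (by fin_cases hx <;> decide)).trans (hF.var (by fin_cases hx <;> decide))
    have hinp' : ω.arr .inp = τ.arr .inp := (hF'.arr (by decide)).trans (hF.arr (by decide))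
    have hrow' : ω.arr .row = υ.arr .row := hF'.arr (by decide)
    have htab : IsTableOf e ω.table := fun a b => by
      rw [← isTableOf_encodeInstance φ e a b, PState.table, hinp', hinp, hrow', hrow a a.2]
      rfl
    refine ⟨⟨?_, ?_, ?_, ?_, ?_, ?_, htab.isOrderTable⟩, htab⟩
    · rw [hvar .n (by decide), hn]
    · rw [hvar .q (by decide), hq]
    · rw [hvar .len (by decide), hlen]
    · rw [hvar .len (by decide), hvar .size (by decide), hlen, hsize]
      lia
    · intro i hi
      rw [hvar .len (by decide), hvar .size (by decide), hlen, hsize, hinp', hinp,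
        ← getD_encodeInstance_code φ e hi, show φ.body.encode.length + 3 + n * n -
          φ.body.encode.length = 3 + n * n by lia]
      rfl
    · intro i hi
      rw [hqrow i hi, Nat.zero_add]
  · have hq := φ.q_le_size
    have hlen := φ.length_encode_le_size
    have h₁ : (φ.body.encode.length + 1) * (n + 1) ^ 2 ≤ (φ.size + 1) * (n + 1) ^ 2 := by gcongr
    have h₂ : 1 * (n + 1) ≤ (φ.size + 1) * (n + 1) ^ 2 :=
      Nat.mul_le_mul (by lia) (Nat.le_self_pow two_ne_zero _)
    have h₃ : (φ.q + 1) * 1 ≤ (φ.size + 1) * (n + 1) ^ 2 :=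
      Nat.mul_le_mul (by lia) (Nat.one_le_pow _ _ n.succ_pos)
    linarith

open Classical in
theorem modelCheck_spec (φ : ExSentence) (e : Fin n ≃ P) :
    modelCheck.Spec (.start (encodeInstance φ e))
      (fun τ => τ.var .res = if φ.Models P then 1 else 0)
      (timeFactor φ.size (posetWidth P) * (n + 1) ^ 2) := by
  refine .le (.seq (loadInput_spec φ e) fun τ _ ⟨hI, hT⟩ =>
    .seq (coverByChains_spec hI.n_eq hI.order hT.widthLE) fun υ hF ⟨hm, hM, hC⟩ =>
    .mono (search_spec (k := υ.var .m) (hI.frame hF (by decide) (by decide)) rfl ?_ hC)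
      (fun ω _ hω => ?_)
      (Nat.mul_le_mul_right _ (searchCost_mono φ.q_le_size hm φ.length_encode_le_size))) ?_
  · rwa [hF.table (by decide) (by decide)]
  · simp only [hω, hT.models_iff, hF.table (s := coverByChains) (by decide) (by decide)]
  · have hn : n + 1 ≤ (n + 1) ^ 2 := Nat.le_self_pow two_ne_zero _
    rw [timeFactor]
    have := Nat.mul_le_mul_left (searchCost φ.size (posetWidth P) φ.size) hn
    lia

end ModelCheck

theorem primrec_two_pow : Primrec fun n : ℕ => 2 ^ n := by
  refine (Primrec.nat_rec₁ (f := fun _ x : ℕ => x + x) 1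
    (Primrec.nat_add.comp .snd .snd)).of_eq fun n => ?_
  induction n with
  | zero => rfl
  | succ n ih =>
    dsimp only at ih ⊢
    rw [ih, pow_succ, Nat.mul_two]

theorem computable_timeFactor : Computable₂ timeFactor := by
  have const (k : ℕ) : Primrec fun _ : ℕ × ℕ => k := .const k
  have add {f g : ℕ × ℕ → ℕ} (hf : Primrec f) (hg : Primrec g) : Primrec fun p => f p + g p :=
    Primrec.nat_add.comp hf hg
  have mul {f g : ℕ × ℕ → ℕ} (hf : Primrec f) (hg : Primrec g) : Primrec fun p => f p * g p :=
    Primrec.nat_mul.comp hf hg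
  have pow {f : ℕ × ℕ → ℕ} (hf : Primrec f) (k : ℕ) : Primrec fun p => f p ^ k :=
    Nat.rec (const 1) (fun _ ih => mul ih hf) k
  have two_pow {f : ℕ × ℕ → ℕ} (hf : Primrec f) : Primrec fun p => 2 ^ f p :=
    primrec_two_pow.comp hf
  have s : Primrec fun p : ℕ × ℕ => p.1 := .fst
  have w : Primrec fun p : ℕ × ℕ => p.2 := .snd
  refine Primrec₂.to_comp ?_
  unfold timeFactor searchCost guessCost Primrec₂
  with_reducible repeat' first
    | exact s | exact w | exact const _ | apply add | apply mul | apply two_pow | apply pow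

open Classical in
theorem theorem1p1 :
    ∃ (p : RamProg) (h : ℕ → ℕ → ℕ) (C : ℕ), Computable₂ h ∧
      ∀ (φ : ExSentence) (P : Type*) [PartialOrder P] (n : ℕ) (e : Fin n ≃ P),
        p.OutputsWithin (encodeInstance φ e) (if φ.Models P then 1 else 0)
          (h φ.size (posetWidth P) * (C * max n 1 ^ 2)) := by
  refine ⟨modelCheck.compile 0 0, timeFactor, 4, computable_timeFactor, fun φ P _ n e => ?_⟩
  obtain ⟨hres, hcost⟩ := modelCheck_spec φ e
  have hn : (n + 1) ^ 2 ≤ 4 * max n 1 ^ 2 :=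
    calc (n + 1) ^ 2 ≤ (2 * max n 1) ^ 2 := Nat.pow_le_pow_left (by lia) 2
      _ = 4 * max n 1 ^ 2 := by ring
  exact modelCheck.outputsWithin _ hres (hcost.trans (Nat.mul_le_mul_left _ hn))
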